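/- **Theorem 4 (the BDDs of the Carry Look Ahead Adder can be constructed polynomially).** An $n$-bit Carry Look Ahead Adder (CLA) has inputs $c_{-1}, a_0, b_0, \dots, a_{n-1}, b_{n-1}$ and consists of two-input AND, OR and XOR gates as follows. * For $0\le i<n$: $p_{i,i}=a_i\oplus b_i$ and $g_{i,i}=a_i\cdot b_i$. * A parallel prefix block is a sequence of cells. The cell for $(j,k,i)$ with $i\le k<j$ computes $p_{j,i}=p_{k,i}\cdot p_{j,k+1}$ and $g_{j,i}=g_{j,k+1}+(g_{k,i}\cdot p_{j,k+1})$ from the intervals $(k,i)$ and $(j,k+1)$, each of which is a single bit position $<n$ or is computed by an earlier cell. No interval $(j,i)$ is computed by two cells, and all intervals $(i,0)$ with $0\le i<n$ are available. * For $0\le i<n$: $c_i=g_{i,0}+p_{i,0}\cdot c_{-1}$ and $s_i=(a_i\oplus b_i)\oplus c_{i-1}$. Symbolic simulation starts from an empty BDD package (a unique table and a computed table, no complemented edges), generates the BDDs of the inputs in the variable order $c_{-1},a_0,b_0,a_1,b_1,\dots,a_{n-1},b_{n-1}$, and then treats the gates in a topological order, carrying out for each one its synthesis operation by means of the $\mathit{ite}$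 algorithm with memoization: $F\cdot G=\mathit{ite}(F,G,0)$, $F+G=\mathit{ite}(F,1,G)$, $F\oplus G=\mathit{ite}(F,\mathit{ite}(G,0,1),G)$. One step is charged for every call of $\mathit{ite}$, and every table lookup is charged as a scan of the whole table (worst-case hashing). There is a polynomial $T$ such that for every $n$ and every $n$-bit CLA, whatever its parallel prefix block, the symbolic simulation terminates successfully with a shared reduced ordered BDD in which every signal of the circuit (all inputs, internal signals and outputs) is represented, and both its running time and the space used (BDD nodes, entries of the computed table, pointers to the BDDs of the signals, recursion stack) are at most $T(n)$. -/

import Mathlib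

namespace PolyAdd

/-! ### BDD manager: shared node store, computed table, and a step counter -/

/-- An inner BDD node: a tested variable together with pointers to its low- and high-successor.
Pointers are natural numbers: `0` and `1` are the terminals, `k + 2` is the `k`-th stored node.
There are no complemented edges. -/
structure Node where
  var : ℕ
  lo : ℕ
  hi : ℕ
  deriving DecidableEq

/-- The inner node a pointer refers to (`none` for the two terminals and for dangling pointers). -/
def nodeAt (nodes : List Node) : ℕ → Option Node
  | 0 => none
  | 1 => none
  | k + 2 => nodes[k]?

/-- The state of a BDD package. -/
structure Manager where
  /-- the unique table, which is also the node store -/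
  nodes : List Node
  /-- the computed table of the `ite` operator -/
  computed : List ((ℕ × ℕ × ℕ) × ℕ)
  /-- the number of elementary steps made so far -/
  time : ℕ

namespace Manager

/-- The initial state: no inner nodes, nothing computed. -/
def empty : Manager := ⟨[], [], 0⟩

/-- Account for `k` elementary steps. -/
def tick (k : ℕ) (M : Manager) : Manager := { M with time := M.time + k }

/-- Find a node in the unique table or add it. The lookup is charged as a scan of the whole table,
i.e. for the worst case of hashing. -/
def findOrAdd (v lo hi : ℕ) (M : Manager) : ℕ × Manager :=
  let M' := M.tick (M.nodes.length + 1)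
  match M.nodes.idxOf? ⟨v, lo, hi⟩ with
  | some k => (k + 2, M')
  | none => (M.nodes.length + 2, { M' with nodes := M.nodes ++ [⟨v, lo, hi⟩] })

/-- A redundant node is not created; any other one comes from the unique table. -/
def reduceOrFind (v lo hi : ℕ) (M : Manager) : ℕ × Manager :=
  if hi = lo then (hi, M) else findOrAdd v lo hi M

/-- The top variable of `F`, `G`, `H` (`none` if all three are terminals). -/
def topVar (M : Manager) (F G H : ℕ) : Option ℕ :=
  (([F, G, H].filterMap (nodeAt M.nodes)).map Node.var).min?

/-- The cofactor of `F` with respect to the value `val` of `v`, for a variable `v` that does not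
come after the top variable of `F`. -/
def cofactor (M : Manager) (v : ℕ) (val : Bool) (F : ℕ) : ℕ :=
  match nodeAt M.nodes F with
  | some nd => if nd.var = v then (if val then nd.hi else nd.lo) else F
  | none => F

/-- Enter a result into the computed table. -/
def insertComputed (F G H R : ℕ) (M : Manager) : Manager :=
  { M with computed := ((F, G, H), R) :: M.computed }

/-- The `ite` algorithm. Every call costs one step (this covers the constant amount of work outside
of the tables); every lookup in the computed or unique table costs one step per table entry on top.
The first argument bounds the recursion depth; the result is `none` if that bound is exceeded. -/
def ite : ℕ → ℕ → ℕ → ℕ → Manager → Option (ℕ × Manager)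
  | 0, _, _, _, _ => none
  | d + 1, F, G, H, M =>
    let M := M.tick 1
    if F = 1 then some (G, M)
    else if F = 0 then some (H, M)
    else if G = H then some (G, M)
    else if G = 1 ∧ H = 0 then some (F, M)
    else
      let M := M.tick (M.computed.length + 1)
      match M.computed.lookup (F, G, H) with
      | some R => some (R, M)
      | none =>
        match M.topVar F G H with
        | none => none
        | some v =>
          match ite d (M.cofactor v true F) (M.cofactor v true G) (M.cofactor v true H) M with
          | none => none
          | some (Rh, M₁) =>
            match ite d (M.cofactor v false F) (M.cofactor v false G) (M.cofactor v false H) M₁ with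
            | none => none
            | some (Rl, M₂) =>
              let (R, M₃) := M₂.reduceOrFind v Rl Rh
              some (R, M₃.insertComputed F G H R)

end Manager

/-! ### Semantics of BDDs -/

/-- `Evaluates nodes x F b`: under the assignment `x` of the variables, the path that starts at the
pointer `F` leads to the terminal `b`. -/
inductive Evaluates (nodes : List Node) (x : ℕ → Bool) : ℕ → Bool → Prop
  | zero : Evaluates nodes x 0 false
  | one : Evaluates nodes x 1 true
  | node {F : ℕ} {nd : Node} {b : Bool} (h : nodeAt nodes F = some nd)
      (hb : Evaluates nodes x (if x nd.var then nd.hi else nd.lo) b) : Evaluates nodes x F b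

/-- `F` represents the Boolean function `f`. -/
def Represents (nodes : List Node) (F : ℕ) (f : (ℕ → Bool) → Bool) : Prop :=
  ∀ x, Evaluates nodes x F (f x)

/-- A pointer to a terminal, or to a stored node that tests a variable after `v`. -/
def ValidBelow (nodes : List Node) (v c : ℕ) : Prop :=
  c = 0 ∨ c = 1 ∨ ∃ nd, nodeAt nodes c = some nd ∧ v < nd.var

/-- The store is a (shared) reduced ordered BDD over the variables `x₀, …, x_{m-1}`. -/
structure IsROBDD (m : ℕ) (nodes : List Node) : Prop where
  var_lt : ∀ nd ∈ nodes, nd.var < m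
  ordered : ∀ nd ∈ nodes, ValidBelow nodes nd.var nd.lo ∧ ValidBelow nodes nd.var nd.hi
  irredundant : ∀ nd ∈ nodes, nd.lo ≠ nd.hi
  unique : nodes.Nodup

/-! ### Circuits and symbolic simulation -/

/-- Gate types. -/
inductive Op
  | and
  | or
  | xor

/-- The Boolean operation of a gate type. -/
def Op.eval : Op → Bool → Bool → Bool
  | .and, p, q => p && q
  | .or, p, q => p || q
  | .xor, p, q => Bool.xor p q

/-- A two-input gate with its output signal and its two input signals. -/
structure Gate (W : Type) where
  out : W
  op : Op
  in₁ : W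
  in₂ : W

/-- A circuit with signals named by `W`: the input signals, listed in the variable order (the
`v`-th input is the variable `x_v`), and the gates, listed in a topological order. -/
structure Circuit (W : Type) where
  inputs : List W
  gates : List (Gate W)

namespace Circuit

variable {W : Type} [DecidableEq W]

/-- All signals of a circuit. -/
def signals (C : Circuit W) : List W := C.inputs ++ C.gates.map Gate.out

/-- The value of every signal under an assignment of the input variables. -/
def value (C : Circuit W) (x : ℕ → Bool) : W → Bool :=
  C.gates.foldl
    (fun e g => Function.update e g.out (g.op.eval (e g.in₁) (e g.in₂)))
    (fun w => x (C.inputs.idxOf w))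

end Circuit

/-- State of a symbolic simulation: the BDD manager, and for the signals treated so far the pointer
to their BDD. -/
structure SimState (W : Type) where
  bdds : List (W × ℕ)
  manager : Manager

/-- The synthesis operation of a gate, carried out by `ite`; without complemented edges an EXOR
takes the negation of one operand first. -/
def Op.synth (d : ℕ) (F G : ℕ) (M : Manager) : Op → Option (ℕ × Manager)
  | .and => M.ite d F G 0
  | .or => M.ite d F 1 G
  | .xor =>
    match M.ite d G 0 1 with
    | none => none
    | some (N, M₁) => M₁.ite d F N G

namespace SimState

variable {W : Type} [DecidableEq W]

/-- Generate the BDD of the input signal `w`, which is the variable `x_v`. -/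
def addInput (S : SimState W) (w : W) (v : ℕ) : SimState W :=
  let (R, M) := (S.manager.tick 1).reduceOrFind v 0 1
  ⟨(w, R) :: S.bdds, M⟩

/-- Treat one gate: get the BDDs of its inputs, each at the cost of a scan of the list of signals,
and carry out the synthesis operation. -/
def addGate (d : ℕ) (S : SimState W) (g : Gate W) : Option (SimState W) :=
  match S.bdds.lookup g.in₁, S.bdds.lookup g.in₂ with
  | some F, some G =>
    match g.op.synth d F G (S.manager.tick (2 * (S.bdds.length + 1))) with
    | some (R, M) => some ⟨(g.out, R) :: S.bdds, M⟩
    | none => none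
  | _, _ => none

end SimState

namespace Circuit

variable {W : Type} [DecidableEq W]

/-- The bound on the recursion depth of `ite`: one more than the number of variables. -/
def depthBound (C : Circuit W) : ℕ := C.inputs.length + 1

/-- Symbolic simulation: first the BDDs of all inputs, then gate by gate in topological order. -/
def simulate (C : Circuit W) : Option (SimState W) :=
  C.gates.foldlM (SimState.addGate C.depthBound)
    (C.inputs.zipIdx.foldl (fun S wv => S.addInput wv.1 wv.2) ⟨[], Manager.empty⟩)

/-- The space used by a simulation of `C` that ends in `S`: BDD nodes with the two terminals,
entries of the computed table, stored signal pointers, and the recursion stack. Nothing is ever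
removed from the tables, so their final sizes are the maximal ones. -/
def space (C : Circuit W) (S : SimState W) : ℕ :=
  S.manager.nodes.length + 2 + S.manager.computed.length + S.bdds.length + C.depthBound

end Circuit

/-! ### The carry look ahead adder -/

/-- A prefix cell, computing `p_{j,i}` and `g_{j,i}` from the intervals `(j, k+1)` and `(k, i)`. -/
structure Cell where
  j : ℕ
  k : ℕ
  i : ℕ

/-- The interval `(j, i)` is a single bit position, or the result of one of the `cells`. -/
def Available (n : ℕ) (cells : List Cell) (j i : ℕ) : Prop :=
  (j = i ∧ i < n) ∨ ∃ c ∈ cells, c.j = j ∧ c.i = i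

/-- A parallel prefix block for `n` bits: prefix cells in topological order, every interval being
computed by at most one cell, such that all the intervals `(i, 0)` are computed. -/
structure PrefixBlock (n : ℕ) where
  cells : List Cell
  split : ∀ c ∈ cells, c.i ≤ c.k ∧ c.k < c.j
  topological : ∀ pre c post, cells = pre ++ c :: post →
    Available n pre c.j (c.k + 1) ∧ Available n pre c.k c.i
  nodup : (cells.map fun c => (c.j, c.i)).Nodup
  complete : ∀ i < n, Available n cells i 0

/-- The signals of the adder. -/
inductive Wire
  /-- the incoming carry `c_{-1}` -/
  | cin
  /-- operand bits -/
  | a (i : ℕ)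
  | b (i : ℕ)
  /-- propagation and generation signals -/
  | p (j i : ℕ)
  | g (j i : ℕ)
  /-- `g_{k,i} · p_{j,k+1}`, in the cell for the interval `(j, i)` -/
  | gp (j i : ℕ)
  /-- `p_{i,0} · c_{-1}` -/
  | pc (i : ℕ)
  /-- carry bits `c_i`, `i ≥ 0` -/
  | c (i : ℕ)
  /-- `a_i ⊕ b_i`, in the computation of the sum bit -/
  | ab (i : ℕ)
  /-- sum bits -/
  | s (i : ℕ)
  deriving DecidableEq

/-- The carry `c_{i-1}` into position `i`. -/
def Wire.carryInto : ℕ → Wire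
  | 0 => .cin
  | i + 1 => .c i

/-- The `n` bit carry look ahead adder with the given prefix block. The variable order is the
interleaved one from the least to the most significant bits: `c_{-1}, a_0, b_0, a_1, b_1, …`. -/
def cla (n : ℕ) (P : PrefixBlock n) : Circuit Wire where
  inputs := .cin :: (List.range n).flatMap fun i => [.a i, .b i]
  gates :=
    ((List.range n).flatMap fun i =>
      [⟨.p i i, .xor, .a i, .b i⟩,
       ⟨.g i i, .and, .a i, .b i⟩]) ++
    (P.cells.flatMap fun c =>
      [⟨.p c.j c.i, .and, .p c.k c.i, .p c.j (c.k + 1)⟩,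
       ⟨.gp c.j c.i, .and, .g c.k c.i, .p c.j (c.k + 1)⟩,
       ⟨.g c.j c.i, .or, .g c.j (c.k + 1), .gp c.j c.i⟩]) ++
    ((List.range n).flatMap fun i =>
      [⟨.pc i, .and, .p i 0, .cin⟩,
       ⟨.c i, .or, .g i 0, .pc i⟩]) ++
    ((List.range n).flatMap fun i =>
      [⟨.ab i, .xor, .a i, .b i⟩,
       ⟨.s i, .xor, .ab i, Wire.carryInto i⟩])

end PolyAdd

namespace PolyAdd

/-! ### Boolean functions: restrictions and dependence on variables -/

/-- The assignment that takes the first `v` variables from `x` and the others from `z`. -/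
def mix (v : ℕ) (x z : ℕ → Bool) : ℕ → Bool := fun u => if u < v then x u else z u

/-- The cofactor of `f` for the values of the first `v` variables given by `x`. -/
def restrict (v : ℕ) (x : ℕ → Bool) (f : (ℕ → Bool) → Bool) : (ℕ → Bool) → Bool :=
  fun z => f (mix v x z)

/-- `f` does not depend on the first `v` variables. -/
def IndepBelow (v : ℕ) (f : (ℕ → Bool) → Bool) : Prop :=
  ∀ x y : ℕ → Bool, (∀ u, v ≤ u → x u = y u) → f x = f y

theorem restrict_zero (x : ℕ → Bool) (f : (ℕ → Bool) → Bool) : restrict 0 x f = f := by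
  funext z
  have : mix 0 x z = z := by
    funext u
    simp [mix]
  rw [restrict, this]

theorem indepBelow_restrict (v : ℕ) (x : ℕ → Bool) (f : (ℕ → Bool) → Bool) :
    IndepBelow v (restrict v x f) := by
  intro y z h
  have : mix v x y = mix v x z := by
    funext u
    by_cases hu : u < v
    · simp [mix, hu]
    · simpa [mix, hu] using h u (by omega)
  simp [restrict, this]

/-- `ite` jumps from level `v` to the top variable `u`. The skipped variables have no influence, so
they may be given the values of `x`; the result is again a cofactor for a full initial segment. -/
theorem restrict_update {v u : ℕ} (hvu : v ≤ u) (b : Bool) (x : ℕ → Bool)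
    {f : (ℕ → Bool) → Bool} (hf : IndepBelow u (restrict v x f)) :
    (fun y => restrict v x f (Function.update y u b)) =
      restrict (u + 1) (Function.update x u b) f := by
  funext y
  rw [hf _ (mix (u + 1) (Function.update x u b) y)]
  · simp only [restrict]
    congr 1
    funext w
    by_cases hw : w < v
    · have h1 : w < u + 1 := by omega
      have h2 : w ≠ u := by omega
      simp [mix, hw, h1, h2]
    · simp [mix, hw]
  · intro w hw
    rcases hw.eq_or_lt with rfl | hlt
    · simp [mix]
    · have h1 : ¬ w < u + 1 := by omega
      have h2 : w ≠ u := by omega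
      simp [mix, h1, h2]

/-! ### Evaluation in an ordered store -/

/-- A pointer to a terminal, or to a stored node that does not test a variable before `v`. -/
def ValidFrom (nodes : List Node) (v c : ℕ) : Prop :=
  c = 0 ∨ c = 1 ∨ ∃ nd, nodeAt nodes c = some nd ∧ v ≤ nd.var

theorem ValidFrom.mono {nodes : List Node} {v w c : ℕ} (hvw : w ≤ v) (h : ValidFrom nodes v c) :
    ValidFrom nodes w c := by
  rcases h with h | h | ⟨nd, h, hv⟩
  · exact .inl h
  · exact .inr (.inl h)
  · exact .inr (.inr ⟨nd, h, hvw.trans hv⟩)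

theorem nodeAt_zero (nodes : List Node) : nodeAt nodes 0 = none := rfl

theorem nodeAt_one (nodes : List Node) : nodeAt nodes 1 = none := rfl

theorem nodeAt_prefix {ns ns' : List Node} (hp : ns <+: ns') {F : ℕ} {nd : Node}
    (h : nodeAt ns F = some nd) : nodeAt ns' F = some nd := by
  obtain ⟨l, rfl⟩ := hp
  match F, h with
  | k + 2, h =>
    simp only [nodeAt] at h ⊢
    rw [List.getElem?_append_left (List.getElem?_eq_some_iff.1 h).1, h]

theorem nodeAt_mem {ns : List Node} {F : ℕ} {nd : Node} (h : nodeAt ns F = some nd) : nd ∈ ns := by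
  match F, h with
  | k + 2, h => exact List.mem_of_getElem? h

theorem ValidFrom.prefix {ns ns' : List Node} (hp : ns <+: ns') {v c : ℕ}
    (h : ValidFrom ns v c) : ValidFrom ns' v c := by
  rcases h with h | h | ⟨nd, h, hv⟩
  · exact .inl h
  · exact .inr (.inl h)
  · exact .inr (.inr ⟨nd, nodeAt_prefix hp h, hv⟩)

theorem Evaluates.prefix {ns ns' : List Node} (hp : ns <+: ns') {x : ℕ → Bool} {F : ℕ} {b : Bool}
    (h : Evaluates ns x F b) : Evaluates ns' x F b := by
  induction h with
  | zero => exact .zero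
  | one => exact .one
  | node h _ ih => exact .node (nodeAt_prefix hp h) ih

theorem Represents.prefix {ns ns' : List Node} (hp : ns <+: ns') {F : ℕ}
    {f : (ℕ → Bool) → Bool} (h : Represents ns F f) : Represents ns' F f :=
  fun x => (h x).prefix hp

theorem Evaluates.unique {ns : List Node} {x : ℕ → Bool} {F : ℕ} {b c : Bool}
    (h : Evaluates ns x F b) (h' : Evaluates ns x F c) : b = c := by
  induction h with
  | zero =>
    cases h' with
    | zero => rfl
    | node h _ => simp [nodeAt_zero] at h
  | one =>
    cases h' with
    | one => rfl
    | node h _ => simp [nodeAt_one] at h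
  | node h _ ih =>
    cases h' with
    | zero => simp [nodeAt_zero] at h
    | one => simp [nodeAt_one] at h
    | node h₂ hb =>
      rw [h] at h₂
      cases h₂
      exact ih hb

theorem Represents.unique {ns : List Node} {F : ℕ} {f g : (ℕ → Bool) → Bool}
    (hf : Represents ns F f) (hg : Represents ns F g) : f = g :=
  funext fun x => (hf x).unique (hg x)

theorem represents_zero (ns : List Node) : Represents ns 0 (fun _ => false) := fun _ => .zero

theorem represents_one (ns : List Node) : Represents ns 1 (fun _ => true) := fun _ => .one

/-- Evaluation gets stuck at a dangling pointer, so representing a function excludes one. -/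
theorem Represents.validFrom_zero {ns : List Node} {F : ℕ} {f : (ℕ → Bool) → Bool}
    (h : Represents ns F f) : ValidFrom ns 0 F := by
  have h0 := h fun _ => false
  generalize f _ = b at h0
  cases h0 with
  | zero => exact .inl rfl
  | one => exact .inr (.inl rfl)
  | node h _ => exact .inr (.inr ⟨_, h, Nat.zero_le _⟩)

namespace IsROBDD

variable {m : ℕ} {ns : List Node}

theorem evaluates_congr (hR : IsROBDD m ns) {x y : ℕ → Bool} {F : ℕ} {b : Bool}
    (h : Evaluates ns x F b) {v : ℕ} (hv : ValidFrom ns v F) (hxy : ∀ u, v ≤ u → x u = y u) :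
    Evaluates ns y F b := by
  induction h generalizing v with
  | zero => exact .zero
  | one => exact .one
  | @node F nd b h hb ih =>
    have hnv : v ≤ nd.var := by
      rcases hv with rfl | rfl | ⟨nd', h', hv'⟩
      · simp [nodeAt_zero] at h
      · simp [nodeAt_one] at h
      · rw [h] at h'
        cases h'
        exact hv'
    refine .node h ?_
    rw [← hxy nd.var hnv]
    -- `ValidBelow` at `nd.var` unfolds to `ValidFrom` at `nd.var + 1`, so `ordered` applies
    -- directly.
    refine ih (v := nd.var + 1) ?_ fun u hu => hxy u (by omega)
    have := hR.ordered nd (nodeAt_mem h)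
    split
    · exact this.2
    · exact this.1

theorem indepBelow (hR : IsROBDD m ns) {F v : ℕ} {f : (ℕ → Bool) → Bool}
    (h : Represents ns F f) (hv : ValidFrom ns v F) : IndepBelow v f :=
  fun x y hxy => (hR.evaluates_congr (h x) hv hxy).unique (h y)

theorem represents_lo (hR : IsROBDD m ns) {F : ℕ} {nd : Node} {f : (ℕ → Bool) → Bool}
    (h : Represents ns F f) (hF : nodeAt ns F = some nd) :
    Represents ns nd.lo (fun x => f (Function.update x nd.var false)) := by
  intro x
  have h0 := h (Function.update x nd.var false)
  change Evaluates ns x nd.lo (f (Function.update x nd.var false))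
  generalize f _ = b at h0 ⊢
  cases h0 with
  | zero => simp [nodeAt_zero] at hF
  | one => simp [nodeAt_one] at hF
  | node h' hb =>
    rw [hF] at h'
    cases h'
    simp only [Function.update_self, Bool.false_eq_true, if_false] at hb
    refine hR.evaluates_congr hb (v := nd.var + 1) (hR.ordered nd (nodeAt_mem hF)).1 fun u hu => ?_
    rw [Function.update_of_ne (by omega)]

theorem represents_hi (hR : IsROBDD m ns) {F : ℕ} {nd : Node} {f : (ℕ → Bool) → Bool}
    (h : Represents ns F f) (hF : nodeAt ns F = some nd) :
    Represents ns nd.hi (fun x => f (Function.update x nd.var true)) := by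
  intro x
  have h0 := h (Function.update x nd.var true)
  change Evaluates ns x nd.hi (f (Function.update x nd.var true))
  generalize f _ = b at h0 ⊢
  cases h0 with
  | zero => simp [nodeAt_zero] at hF
  | one => simp [nodeAt_one] at hF
  | node h' hb =>
    rw [hF] at h'
    cases h'
    simp only [Function.update_self, if_true] at hb
    refine hR.evaluates_congr hb (v := nd.var + 1) (hR.ordered nd (nodeAt_mem hF)).2 fun u hu => ?_
    rw [Function.update_of_ne (by omega)]

theorem nodeAt_inj (hR : IsROBDD m ns) {F G : ℕ} {nd : Node} (hF : nodeAt ns F = some nd)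
    (hG : nodeAt ns G = some nd) : F = G := by
  match F, G, hF, hG with
  | k + 2, l + 2, hF, hG =>
    simp only [nodeAt] at hF hG
    have hk := (List.getElem?_eq_some_iff.1 hF).1
    rw [(List.getElem?_inj hk hR.unique).1 (hF.trans hG.symm)]

theorem update_eq_of_indepBelow {u : ℕ} {f : (ℕ → Bool) → Bool} (hf : IndepBelow (u + 1) f)
    (b : Bool) : (fun x => f (Function.update x u b)) = f := by
  funext x
  refine hf _ _ fun w hw => ?_
  rw [Function.update_of_ne (by omega)]

/-- In a reduced ordered BDD a function is represented by one pointer only. -/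
theorem canonical (hR : IsROBDD m ns) {F G : ℕ} {f : (ℕ → Bool) → Bool}
    (hF : Represents ns F f) (hG : Represents ns G f) : F = G := by
  -- Induction on the number `k` of variables that may still be tested, namely those from `m - k`
  -- on.
  suffices H : ∀ k, ∀ F G f, Represents ns F f → Represents ns G f → ValidFrom ns (m - k) F →
      ValidFrom ns (m - k) G → F = G by
    have hm : m - m = 0 := by omega
    exact H m F G f hF hG (hm ▸ hF.validFrom_zero) (hm ▸ hG.validFrom_zero)
  intro k
  induction k with
  | zero =>
    intro F G f hF hG vF vG
    have key : ∀ {c}, ValidFrom ns (m - 0) c → c = 0 ∨ c = 1 := by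
      rintro c (h | h | ⟨nd, h, hv⟩)
      · exact .inl h
      · exact .inr h
      · have := hR.var_lt nd (nodeAt_mem h)
        omega
    rcases key vF with rfl | rfl <;> rcases key vG with rfl | rfl
    · rfl
    · exact absurd (congrFun ((represents_zero ns).unique hF |>.trans
        (hG.unique (represents_one ns))) fun _ => false) (by simp)
    · exact absurd (congrFun ((represents_zero ns).unique hG |>.trans
        (hF.unique (represents_one ns))) fun _ => false) (by simp)
    · rfl
  | succ k ih =>
    -- If the function ignored the variable of its node, both successors would represent it and be
    -- equal by induction, against irredundancy.
    have redundant : ∀ {F f nd}, Represents ns F f → nodeAt ns F = some nd →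
        m - (k + 1) ≤ nd.var → ¬ IndepBelow (nd.var + 1) f := by
      intro F f nd hF hnd hv hf
      have h1 := hR.represents_lo hF hnd
      have h2 := hR.represents_hi hF hnd
      rw [update_eq_of_indepBelow hf] at h1 h2
      have ho := hR.ordered nd (nodeAt_mem hnd)
      exact hR.irredundant nd (nodeAt_mem hnd) (ih _ _ _ h1 h2
        (ValidFrom.mono (v := nd.var + 1) (by omega) ho.1)
        (ValidFrom.mono (v := nd.var + 1) (by omega) ho.2))
    intro F G f hF hG vF vG
    have terminal : ∀ {F G}, Represents ns F f → Represents ns G f → F = 0 ∨ F = 1 →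
        ValidFrom ns (m - (k + 1)) G → F = G := by
      intro F G hF hG hF01 vG
      have hf : ∀ v, IndepBelow v f := fun v => hR.indepBelow hF (by
        rcases hF01 with h | h
        · exact .inl h
        · exact .inr (.inl h))
      rcases vG with h | h | ⟨nd, h, hv⟩
      · rcases hF01 with rfl | rfl
        · exact h.symm
        · subst h
          exact absurd (congrFun ((represents_zero ns).unique hG |>.trans
            (hF.unique (represents_one ns))) fun _ => false) (by simp)
      · rcases hF01 with rfl | rfl
        · subst h
          exact absurd (congrFun ((represents_zero ns).unique hF |>.trans
            (hG.unique (represents_one ns))) fun _ => false) (by simp)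
        · exact h.symm
      · exact absurd (hf _) (redundant hG h hv)
    rcases vF with h | h | ⟨nF, hnF, hvF⟩
    · exact terminal hF hG (.inl h) vG
    · exact terminal hF hG (.inr h) vG
    rcases vG with h | h | ⟨nG, hnG, hvG⟩
    · exact (terminal hG hF (.inl h) (.inr (.inr ⟨nF, hnF, hvF⟩))).symm
    · exact (terminal hG hF (.inr h) (.inr (.inr ⟨nF, hnF, hvF⟩))).symm
    -- With different top variables, the function would ignore the earlier one, since the other
    -- pointer never tests it.
    rcases lt_trichotomy nF.var nG.var with hlt | heq | hlt
    · exact absurd (hR.indepBelow hG (.inr (.inr ⟨nG, hnG, hlt⟩))) (redundant hF hnF hvF)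
    · have oF := hR.ordered nF (nodeAt_mem hnF)
      have oG := hR.ordered nG (nodeAt_mem hnG)
      have e1 := ih _ _ _ (hR.represents_lo hF hnF) (heq ▸ hR.represents_lo hG hnG)
        (ValidFrom.mono (v := nF.var + 1) (by omega) oF.1)
        (ValidFrom.mono (v := nG.var + 1) (by omega) oG.1)
      have e2 := ih _ _ _ (hR.represents_hi hF hnF) (heq ▸ hR.represents_hi hG hnG)
        (ValidFrom.mono (v := nF.var + 1) (by omega) oF.2)
        (ValidFrom.mono (v := nG.var + 1) (by omega) oG.2)
      have : nF = nG := by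
        cases nF
        cases nG
        simp_all
      subst this
      exact hR.nodeAt_inj hnF hnG
    · exact absurd (hR.indepBelow hF (.inr (.inr ⟨nF, hnF, hlt⟩))) (redundant hG hnG hvG)

/-- The converse of `indepBelow`: an ignored top variable would give two successors with the same
function, hence a redundant node. -/
theorem validFrom (hR : IsROBDD m ns) {F v : ℕ} {f : (ℕ → Bool) → Bool}
    (hF : Represents ns F f) (hf : IndepBelow v f) : ValidFrom ns v F := by
  rcases hF.validFrom_zero with h | h | ⟨nd, h, -⟩
  · exact .inl h
  · exact .inr (.inl h)
  · refine .inr (.inr ⟨nd, h, ?_⟩)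
    by_contra hlt
    have hf' : IndepBelow (nd.var + 1) f := fun x y hxy => hf x y fun u hu => hxy u (by omega)
    have h1 := hR.represents_lo hF h
    have h2 := hR.represents_hi hF h
    rw [update_eq_of_indepBelow hf'] at h1 h2
    exact hR.irredundant nd (nodeAt_mem h) (hR.canonical h1 h2)

end IsROBDD

/-! ### The unique table -/

theorem represents_node {ns : List Node} {R u lo hi : ℕ} {fl fh : (ℕ → Bool) → Bool}
    (hR : nodeAt ns R = some ⟨u, lo, hi⟩) (hlo : Represents ns lo fl) (hhi : Represents ns hi fh) :
    Represents ns R (fun x => bif x u then fh x else fl x) := by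
  intro x
  refine .node hR ?_
  cases hx : x u
  · simpa [hx] using hlo x
  · simpa [hx] using hhi x

namespace Manager

theorem reduceOrFind_spec {m u lo hi : ℕ} {M : Manager} {fl fh : (ℕ → Bool) → Bool}
    (hM : IsROBDD m M.nodes) (hu : u < m) (hlo : Represents M.nodes lo fl)
    (hhi : Represents M.nodes hi fh) (vlo : ValidFrom M.nodes (u + 1) lo)
    (vhi : ValidFrom M.nodes (u + 1) hi) :
    ∃ R M', M.reduceOrFind u lo hi = (R, M') ∧ IsROBDD m M'.nodes ∧ M.nodes <+: M'.nodes ∧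
      Represents M'.nodes R (fun x => bif x u then fh x else fl x) ∧
      M'.computed = M.computed ∧ M'.nodes.length ≤ M.nodes.length + 1 ∧
      M'.time ≤ M.time + (M.nodes.length + 1) := by
  unfold reduceOrFind
  split
  case isTrue h =>
    subst h
    refine ⟨_, _, rfl, hM, List.prefix_refl _, ?_, rfl, by omega, by omega⟩
    rw [hlo.unique hhi]
    simpa using hhi
  case isFalse h =>
    unfold findOrAdd
    cases hk : M.nodes.idxOf? ⟨u, lo, hi⟩ with
    | some k =>
      refine ⟨_, _, rfl, hM, List.prefix_refl _, ?_, rfl, by simp [tick], by simp [tick]⟩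
      refine represents_node ?_ hlo hhi
      simp only [tick, nodeAt]
      rw [List.idxOf?, List.findIdx?_eq_some_iff_getElem] at hk
      obtain ⟨hk, he, -⟩ := hk
      rw [List.getElem?_eq_getElem hk]
      simpa using he
    | none =>
      have hnew : (⟨u, lo, hi⟩ : Node) ∉ M.nodes := by
        simpa [List.idxOf?_eq_none_iff] using hk
      have hp : M.nodes <+: M.nodes ++ [⟨u, lo, hi⟩] := List.prefix_append _ _
      refine ⟨_, _, rfl, ?_, hp, ?_, rfl, by simp, by simp [tick]⟩
      · constructor
        · intro nd hnd
          rcases List.mem_append.1 hnd with hnd | hnd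
          · exact hM.var_lt nd hnd
          · rw [List.mem_singleton.1 hnd]
            exact hu
        · intro nd hnd
          rcases List.mem_append.1 hnd with hnd | hnd
          · exact ⟨ValidFrom.prefix (v := nd.var + 1) hp (hM.ordered nd hnd).1,
              ValidFrom.prefix (v := nd.var + 1) hp (hM.ordered nd hnd).2⟩
          · rw [List.mem_singleton.1 hnd]
            exact ⟨vlo.prefix hp, vhi.prefix hp⟩
        · intro nd hnd
          rcases List.mem_append.1 hnd with hnd | hnd
          · exact hM.irredundant nd hnd
          · rw [List.mem_singleton.1 hnd]
            exact fun h' => h h'.symm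
        · exact List.nodup_append.2 ⟨hM.unique, by simp, by
            intro a ha b hb
            rw [List.mem_singleton.1 hb]
            exact fun hab => hnew (hab ▸ ha)⟩
      · exact represents_node (by simp [nodeAt]) (hlo.prefix hp) (hhi.prefix hp)

end Manager

end PolyAdd

namespace PolyAdd

/-! ### The `ite` algorithm -/

/-- The `ite` operator on Boolean functions. -/
def iteFun (f g h : (ℕ → Bool) → Bool) : (ℕ → Bool) → Bool := fun x => bif f x then g x else h x

namespace Manager

/-- The unique table is a reduced ordered BDD, and the computed table has one correct entry for
each of its keys. -/
structure Inv (m : ℕ) (M : Manager) : Prop where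
  robdd : IsROBDD m M.nodes
  keys : (M.computed.map Prod.fst).Nodup
  sound : ∀ e ∈ M.computed, ∃ f g h, Represents M.nodes e.1.1 f ∧ Represents M.nodes e.1.2.1 g ∧
    Represents M.nodes e.1.2.2 h ∧ Represents M.nodes e.2 (iteFun f g h)

theorem Inv.tick {m k : ℕ} {M : Manager} (h : Inv m M) : Inv m (M.tick k) := ⟨h.1, h.2, h.3⟩

/-- The triple of pointers `K` represents cofactors of `f`, `g`, `h`, all of them for the same
values of the first `w` variables, where `v ≤ w ≤ m`. -/
def IsCofactorKey (m v : ℕ) (f g h : (ℕ → Bool) → Bool) (nodes : List Node) (K : ℕ × ℕ × ℕ) :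
    Prop :=
  ∃ w x, v ≤ w ∧ w ≤ m ∧ Represents nodes K.1 (restrict w x f) ∧
    Represents nodes K.2.1 (restrict w x g) ∧ Represents nodes K.2.2 (restrict w x h)

theorem IsCofactorKey.mono {m v v' : ℕ} {f g h : (ℕ → Bool) → Bool} {ns ns' : List Node}
    {K : ℕ × ℕ × ℕ} (hK : IsCofactorKey m v f g h ns K) (hv : v' ≤ v) (hp : ns <+: ns') :
    IsCofactorKey m v' f g h ns' K := by
  obtain ⟨w, x, h1, h2, h3, h4, h5⟩ := hK
  exact ⟨w, x, hv.trans h1, h2, h3.prefix hp, h4.prefix hp, h5.prefix hp⟩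

/-- What a call of `ite` on cofactors of `f`, `g`, `h` at level `v` does to the manager; `r` is
the function represented by the result `R`. -/
structure ItePost (m v : ℕ) (f g h r : (ℕ → Bool) → Bool) (M : Manager) (R : ℕ)
    (M' : Manager) : Prop where
  inv : Inv m M'
  nodes_prefix : M.nodes <+: M'.nodes
  represents : Represents M'.nodes R r
  table : ∃ L, M'.computed = L ++ M.computed ∧
    (∀ e ∈ L, IsCofactorKey m v f g h M'.nodes e.1) ∧
    M'.nodes.length ≤ M.nodes.length + L.length ∧
    -- At most `2 * L.length + 1` calls occur: the outer one and two for each new entry. Each costs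
    -- at most one scan of either table plus 3; measuring by the final tables avoids any bound known
    -- in advance.
    M'.time ≤ M.time + (2 * L.length + 1) * (M'.computed.length + M'.nodes.length + 3)

theorem ItePost.of_unchanged {m v k R : ℕ} {f g h r : (ℕ → Bool) → Bool} {M : Manager}
    (hM : Inv m M) (hR : Represents M.nodes R r)
    (hk : k ≤ M.computed.length + M.nodes.length + 3) :
    ItePost m v f g h r M R (M.tick k) :=
  ⟨hM.tick, List.prefix_refl _, hR, [], rfl, by simp, by simp [tick], by simpa [tick] using hk⟩

theorem topVar_le {M : Manager} {F G H u P : ℕ} {nd : Node} (h : M.topVar F G H = some u)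
    (hP : P ∈ [F, G, H]) (hnd : nodeAt M.nodes P = some nd) : u ≤ nd.var := by
  refine (List.min?_eq_some_iff.1 h).2 _ ?_
  exact List.mem_map.2 ⟨nd, List.mem_filterMap.2 ⟨P, hP, hnd⟩, rfl⟩

theorem topVar_mem {M : Manager} {F G H u : ℕ} (h : M.topVar F G H = some u) :
    ∃ P ∈ [F, G, H], ∃ nd, nodeAt M.nodes P = some nd ∧ nd.var = u := by
  obtain ⟨nd, hnd, rfl⟩ := List.mem_map.1 (List.min?_eq_some_iff.1 h).1
  obtain ⟨P, hP, hnd⟩ := List.mem_filterMap.1 hnd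
  exact ⟨P, hP, nd, hnd, rfl⟩

theorem topVar_ne_none {M : Manager} {F G H : ℕ} {nd : Node} (h : nodeAt M.nodes F = some nd) :
    M.topVar F G H ≠ none := by
  simp [topVar, h]

theorem validFrom_topVar {M : Manager} {F G H u P : ℕ} {f : (ℕ → Bool) → Bool}
    (h : M.topVar F G H = some u) (hP : P ∈ [F, G, H]) (hf : Represents M.nodes P f) :
    ValidFrom M.nodes u P := by
  rcases hf.validFrom_zero with h0 | h0 | ⟨nd, h0, -⟩
  · exact .inl h0
  · exact .inr (.inl h0)
  · exact .inr (.inr ⟨nd, h0, topVar_le h hP h0⟩)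

theorem cofactor_represents {m u F : ℕ} {M : Manager} {f : (ℕ → Bool) → Bool}
    (hM : IsROBDD m M.nodes) (hF : Represents M.nodes F f) (hv : ValidFrom M.nodes u F) (b : Bool) :
    Represents M.nodes (M.cofactor u b F) (fun x => f (Function.update x u b)) := by
  have same : ValidFrom M.nodes (u + 1) F →
      Represents M.nodes F (fun x => f (Function.update x u b)) := fun h => by
    rwa [IsROBDD.update_eq_of_indepBelow (hM.indepBelow hF h)]
  rcases hv with rfl | rfl | ⟨nd, h, hu⟩
  · exact same (.inl rfl)
  · exact same (.inr (.inl rfl))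
  · simp only [cofactor, h]
    split
    case isTrue e =>
      subst e
      cases b
      · exact hM.represents_lo hF h
      · exact hM.represents_hi hF h
    case isFalse e => exact same (.inr (.inr ⟨nd, h, by omega⟩))

/-- The recursive calls concern levels after the top variable `u`, where no pointer of a key tests
`u`. So they cannot enter the key of the calling `ite`, which is entered only after they return. -/
theorem IsCofactorKey.ne_of_topVar {m : ℕ} {M : Manager} {ns : List Node}
    (hp : M.nodes <+: ns) (hns : IsROBDD m ns) {F G H u : ℕ} {f g h : (ℕ → Bool) → Bool}
    (hu : M.topVar F G H = some u) : ¬ IsCofactorKey m (u + 1) f g h ns (F, G, H) := by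
  rintro ⟨w, x, hw, -, hF, hG, hH⟩
  obtain ⟨P, hP, nd, hnd, rfl⟩ := topVar_mem hu
  have hP' : ValidFrom ns w P := by
    simp only [List.mem_cons, List.not_mem_nil, or_false] at hP
    rcases hP with rfl | rfl | rfl
    · exact hns.validFrom hF (indepBelow_restrict _ _ _)
    · exact hns.validFrom hG (indepBelow_restrict _ _ _)
    · exact hns.validFrom hH (indepBelow_restrict _ _ _)
  have hnd' := nodeAt_prefix hp hnd
  rcases hP' with rfl | rfl | ⟨nd', h', hv⟩
  · simp [nodeAt_zero] at hnd
  · simp [nodeAt_one] at hnd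
  · rw [hnd'] at h'
    cases h'
    omega

/-- The functions `f`, `g`, `h` stay fixed through the recursion, so every key is recorded as a
cofactor of the outermost operands. Each recursive call raises the level `v` by at least one, which
preserves `m < v + d` while `d` drops. -/
theorem ite_spec {m : ℕ} {f g h : (ℕ → Bool) → Bool} (d : ℕ) :
    ∀ {v F G H : ℕ} {x : ℕ → Bool} {M : Manager}, Inv m M → v ≤ m → m < v + d →
      Represents M.nodes F (restrict v x f) → Represents M.nodes G (restrict v x g) →
      Represents M.nodes H (restrict v x h) →
      ∃ R M', M.ite d F G H = some (R, M') ∧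
        ItePost m v f g h (iteFun (restrict v x f) (restrict v x g) (restrict v x h)) M R M' := by
  induction d with
  | zero =>
    intros
    omega
  | succ d ih =>
    intro v F G H x M hM hvm hd hF hG hH
    by_cases hF1 : F = 1
    · subst hF1
      refine ⟨_, _, by simp [ite]; exact ⟨rfl, rfl⟩, .of_unchanged hM ?_ (by omega)⟩
      rw [show restrict v x f = _ from hF.unique (represents_one _)]
      exact hG
    by_cases hF0 : F = 0
    · subst hF0
      refine ⟨_, _, by simp [ite]; exact ⟨rfl, rfl⟩, .of_unchanged hM ?_ (by omega)⟩
      rw [show restrict v x f = _ from hF.unique (represents_zero _)]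
      exact hH
    by_cases hGH : G = H
    · subst hGH
      refine ⟨_, _, by simp [ite, hF1, hF0]; exact ⟨rfl, rfl⟩, .of_unchanged hM ?_ (by omega)⟩
      have : iteFun (restrict v x f) (restrict v x g) (restrict v x h) = restrict v x g := by
        funext y
        rw [iteFun, hG.unique hH]
        simp
      rwa [this]
    by_cases hG1 : G = 1 ∧ H = 0
    · obtain ⟨rfl, rfl⟩ := hG1
      refine ⟨_, _, by simp [ite, hF1, hF0]; exact ⟨rfl, rfl⟩, .of_unchanged hM ?_ (by omega)⟩
      have : iteFun (restrict v x f) (restrict v x g) (restrict v x h) = restrict v x f := by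
        funext y
        rw [iteFun, hG.unique (represents_one _), hH.unique (represents_zero _)]
        simp
      rwa [this]
    rw [ite]
    simp only [hF1, hF0, hGH, hG1, if_false]
    set M₀ := (M.tick 1).tick ((M.tick 1).computed.length + 1) with hM₀
    have hI₀ : Inv m M₀ := hM.tick.tick
    have hM₀' : M₀ = M.tick (M.computed.length + 2) := by
      simp [hM₀, tick]
      omega
    cases hl : M₀.computed.lookup (F, G, H) with
    | some R =>
      simp only
      refine ⟨_, _, rfl, ?_⟩
      rw [hM₀']
      refine .of_unchanged hM ?_ (by omega)
      obtain ⟨f', g', h', e1, e2, e3, e4⟩ := hM.sound ((F, G, H), R) (by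
        obtain ⟨l₁, l₂, e, -⟩ := List.lookup_eq_some_iff.1 hl
        change M.computed = _ at e
        rw [e]
        simp)
      rwa [hF.unique e1, hG.unique e2, hH.unique e3]
    | none =>
      simp only
      have hkey : ∀ e ∈ M.computed, e.1 ≠ (F, G, H) := by
        intro e he h'
        have := List.lookup_eq_none_iff.1 hl e he
        simp [h'] at this
      have hFn : ∃ nd, nodeAt M₀.nodes F = some nd := by
        rcases hF.validFrom_zero with h | h | ⟨nd, h, -⟩
        · exact absurd h hF0
        · exact absurd h hF1
        · exact ⟨nd, h⟩
      obtain ⟨nd, hnd⟩ := hFn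
      cases ht : M₀.topVar F G H with
      | none => exact absurd ht (topVar_ne_none hnd)
      | some u =>
        simp only
        obtain ⟨P, hP, ndP, hndP, rfl⟩ := topVar_mem ht
        have hum : ndP.var < m := hI₀.robdd.var_lt _ (nodeAt_mem hndP)
        have hvu : v ≤ ndP.var := by
          have : ValidFrom M₀.nodes v P := by
            simp only [List.mem_cons, List.not_mem_nil, or_false] at hP
            rcases hP with rfl | rfl | rfl
            · exact hI₀.robdd.validFrom hF (indepBelow_restrict _ _ _)
            · exact hI₀.robdd.validFrom hG (indepBelow_restrict _ _ _)
            · exact hI₀.robdd.validFrom hH (indepBelow_restrict _ _ _)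
          rcases this with rfl | rfl | ⟨nd', h', hv⟩
          · simp [nodeAt_zero] at hndP
          · simp [nodeAt_one] at hndP
          · rw [hndP] at h'
            cases h'
            exact hv
        generalize ndP.var = u at *
        have cof : ∀ {P : ℕ} {k : (ℕ → Bool) → Bool}, P ∈ [F, G, H] →
            Represents M₀.nodes P (restrict v x k) → ∀ b : Bool,
            (fun y => restrict v x k (Function.update y u b)) =
              restrict (u + 1) (Function.update x u b) k ∧
            Represents M₀.nodes (M₀.cofactor u b P)
              (restrict (u + 1) (Function.update x u b) k) := by
          intro P k hP hk b
          have hv := validFrom_topVar ht hP hk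
          have e := restrict_update hvu b x (hI₀.robdd.indepBelow hk hv)
          exact ⟨e, e ▸ cofactor_represents hI₀.robdd hk hv b⟩
        have cF := cof (P := F) (k := f) (by simp) hF
        have cG := cof (P := G) (k := g) (by simp) hG
        have cH := cof (P := H) (k := h) (by simp) hH
        obtain ⟨Rh, M₁, e₁, p₁⟩ := ih hI₀ (Nat.succ_le_of_lt hum) (by omega)
          (cF true).2 (cG true).2 (cH true).2
        rw [e₁]
        simp only
        obtain ⟨Rl, M₂, e₂, p₂⟩ := ih p₁.inv (Nat.succ_le_of_lt hum) (by omega)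
          ((cF false).2.prefix p₁.nodes_prefix) ((cG false).2.prefix p₁.nodes_prefix)
          ((cH false).2.prefix p₁.nodes_prefix)
        rw [e₂]
        simp only
        have indep : ∀ b, IndepBelow (u + 1)
            (iteFun (restrict (u + 1) (Function.update x u b) f)
              (restrict (u + 1) (Function.update x u b) g)
              (restrict (u + 1) (Function.update x u b) h)) := by
          intro b y z hyz
          simp only [iteFun]
          rw [indepBelow_restrict _ _ f _ _ hyz, indepBelow_restrict _ _ g _ _ hyz,
            indepBelow_restrict _ _ h _ _ hyz]
        have rh := p₁.represents.prefix p₂.nodes_prefix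
        obtain ⟨R, M₃, e₃, i₃, pre₃, rep₃, comp₃, len₃, time₃⟩ := reduceOrFind_spec
          p₂.inv.robdd hum p₂.represents rh (p₂.inv.robdd.validFrom p₂.represents (indep false))
          (p₂.inv.robdd.validFrom rh (indep true))
        rw [e₃]
        simp only
        refine ⟨_, _, rfl, ?_⟩
        obtain ⟨L₁, l₁, k₁, n₁, t₁⟩ := p₁.table
        obtain ⟨L₂, l₂, k₂, n₂, t₂⟩ := p₂.table
        have pre₀ : M.nodes <+: M₃.nodes := (p₁.nodes_prefix.trans p₂.nodes_prefix).trans pre₃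
        have rep : Represents M₃.nodes R
            (iteFun (restrict v x f) (restrict v x g) (restrict v x h)) := by
          convert rep₃ using 1
          funext y
          have hy : Function.update y u (y u) = y := Function.update_eq_self _ _
          have ef := congrFun (cF (y u)).1 y
          have eg := congrFun (cG (y u)).1 y
          have eh := congrFun (cH (y u)).1 y
          simp only [hy] at ef eg eh
          cases hyu : y u <;> simp only [hyu] at ef eg eh <;> simp [iteFun, ef, eg, eh]
        have hcomp : M₃.computed = L₂ ++ (L₁ ++ M.computed) := by
          rw [comp₃, l₂, l₁, hM₀]
          rfl
        have hL : ∀ e ∈ L₂ ++ L₁, IsCofactorKey m (u + 1) f g h M₃.nodes e.1 := by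
          intro e he
          rcases List.mem_append.1 he with he | he
          · exact (k₂ e he).mono le_rfl pre₃
          · exact (k₁ e he).mono le_rfl (p₂.nodes_prefix.trans pre₃)
        refine ⟨⟨i₃, ?_, ?_⟩, pre₀, rep, ((F, G, H), R) :: (L₂ ++ L₁), ?_, ?_, ?_, ?_⟩
        · simp only [insertComputed, List.map_cons, List.nodup_cons]
          -- The new key differs from the recursive ones by the level argument and from the older
          -- ones because the lookup failed.
          refine ⟨?_, comp₃ ▸ p₂.inv.keys⟩
          rw [hcomp, ← List.append_assoc]
          intro hmem
          obtain ⟨e, he, hek⟩ := List.mem_map.1 hmem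
          rcases List.mem_append.1 he with he | he
          · exact IsCofactorKey.ne_of_topVar (M := M₀) pre₀ i₃ ht (hek ▸ hL e he)
          · exact hkey e he hek
        · intro e he
          rcases List.mem_cons.1 he with rfl | he
          · exact ⟨_, _, _, hF.prefix pre₀, hG.prefix pre₀, hH.prefix pre₀, rep⟩
          · rw [comp₃] at he
            obtain ⟨f', g', h', a1, a2, a3, a4⟩ := p₂.inv.sound e he
            exact ⟨f', g', h', a1.prefix pre₃, a2.prefix pre₃, a3.prefix pre₃, a4.prefix pre₃⟩
        · simp [insertComputed, hcomp]
        · intro e he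
          rcases List.mem_cons.1 he with rfl | he
          · exact ⟨v, x, le_rfl, hvm, hF.prefix pre₀, hG.prefix pre₀, hH.prefix pre₀⟩
          · exact (hL e he).mono (by omega) (List.prefix_refl _)
        · simp only [insertComputed, List.length_cons, List.length_append]
          have : M₀.nodes = M.nodes := rfl
          rw [this] at n₁
          omega
        · have c₁ := congrArg List.length l₁
          have c₂ := congrArg List.length l₂
          have c₀ : M₀.computed = M.computed := rfl
          have t₀ : M₀.time = M.time + (M.computed.length + 2) := by rw [hM₀']; rfl
          have q₂ := p₂.nodes_prefix.length_le
          have q₃ := pre₃.length_le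
          simp only [insertComputed, List.length_cons, List.length_append, comp₃] at *
          -- `K` majorizes the cost of one call by final table sizes. The call's own work is
          -- `M.computed.length + 2` for step and lookup, plus at most `M₂.nodes.length + 1` for the
          -- unique table.
          set K := M₂.computed.length + 1 + M₃.nodes.length + 3 with hK
          have b₁ : (2 * L₁.length + 1) * (M₁.computed.length + M₁.nodes.length + 3) ≤
              (2 * L₁.length + 1) * K := Nat.mul_le_mul_left _ (by omega)
          have b₂ : (2 * L₂.length + 1) * (M₂.computed.length + M₂.nodes.length + 3) ≤
              (2 * L₂.length + 1) * K := Nat.mul_le_mul_left _ (by omega)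
          have b₃ : (2 * (L₂.length + L₁.length + 1) + 1) * K =
              (2 * L₁.length + 1) * K + (2 * L₂.length + 1) * K + K := by ring
          rw [b₃]
          have : M₀.computed.length = M.computed.length := rfl
          omega

end Manager

end PolyAdd

namespace PolyAdd

/-! ### Functions with few cofactors -/

/-- For every `v`, the function `f` has at most `w` cofactors with respect to the first `v`
variables. -/
def Width (w : ℕ) (f : (ℕ → Bool) → Bool) : Prop :=
  ∀ v, ∃ t : Finset ((ℕ → Bool) → Bool), t.card ≤ w ∧ ∀ x, restrict v x f ∈ t

theorem Width.mono {w w' : ℕ} {f : (ℕ → Bool) → Bool} (h : Width w f) (hw : w ≤ w') :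
    Width w' f := fun v =>
  let ⟨t, ht, hm⟩ := h v
  ⟨t, ht.trans hw, hm⟩

theorem width_const (b : Bool) : Width 1 (fun _ => b) := fun v =>
  ⟨{fun _ => b}, by simp, fun _ => Finset.mem_singleton.2 rfl⟩

open Classical in
-- Taking cofactors commutes with pointwise operations, so a cofactor of the result is determined by
-- a pair of cofactors.
theorem Width.op {w w' : ℕ} {f g : (ℕ → Bool) → Bool} (hf : Width w f) (hg : Width w' g)
    (o : Bool → Bool → Bool) : Width (w * w') (fun x => o (f x) (g x)) := fun v => by
  obtain ⟨s, hs, ms⟩ := hf v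
  obtain ⟨t, ht, mt⟩ := hg v
  refine ⟨Finset.image₂ (fun f g x => o (f x) (g x)) s t, ?_, fun x => ?_⟩
  · exact Finset.card_image₂_le _ _ _ |>.trans (Nat.mul_le_mul hs ht)
  · exact Finset.mem_image₂.2 ⟨_, ms x, _, mt x, rfl⟩

theorem Width.not {w : ℕ} {f : (ℕ → Bool) → Bool} (hf : Width w f) :
    Width w (fun x => !f x) := by
  simpa using hf.op (width_const true) (fun a _ => !a)

open Classical in
/-- A function whose cofactors are determined by a state from a finite set. -/
theorem Width.of_state {τ : Type} [Fintype τ] {f : (ℕ → Bool) → Bool}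
    (σ : ℕ → (ℕ → Bool) → τ)
    (h : ∀ v x y z, σ v x = σ v y → f (mix v x z) = f (mix v y z)) :
    Width (Fintype.card τ) f := fun v => by
  refine ⟨Finset.univ.image fun s =>
    -- Each reached state gets the cofactor of one chosen assignment; `f` is a dummy value for
    -- unreached states.
    if hs : ∃ x, σ v x = s then restrict v hs.choose f else f, Finset.card_image_le, fun x => ?_⟩
  refine Finset.mem_image.2 ⟨σ v x, Finset.mem_univ _, ?_⟩
  have hs : ∃ y, σ v y = σ v x := ⟨x, rfl⟩
  rw [dif_pos hs]
  funext z
  exact h v _ _ z hs.choose_spec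

theorem width_var (u : ℕ) : Width 2 (fun x => x u) := by
  refine Width.of_state (τ := Bool) (fun _ x => x u) fun v x y z h => ?_
  simp only [mix]
  split
  · exact h
  · rfl

namespace Manager

open Classical in
-- There are `m + 1` levels with at most `w ^ 3` triples of cofactors each, and canonicity makes the
-- map from keys to such triples injective.
theorem length_le_of_cofactorKeys {m w : ℕ} {f g h : (ℕ → Bool) → Bool} {ns : List Node}
    (hns : IsROBDD m ns) (hf : Width w f) (hg : Width w g) (hh : Width w h)
    {L : List (ℕ × ℕ × ℕ)} (hL : L.Nodup)
    (hk : ∀ K ∈ L, IsCofactorKey m 0 f g h ns K) : L.length ≤ (m + 1) * w ^ 3 := by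
  choose s hs ms using hf
  choose t ht mt using hg
  choose r hr mr using hh
  let B := (Finset.range (m + 1)).biUnion fun v => s v ×ˢ t v ×ˢ r v
  have hB : B.card ≤ (m + 1) * w ^ 3 := by
    refine (Finset.card_biUnion_le_card_mul _ _ (w ^ 3) fun v _ => ?_).trans (by simp)
    rw [Finset.card_product, Finset.card_product, pow_succ', pow_two]
    exact Nat.mul_le_mul (hs v) (Nat.mul_le_mul (ht v) (hr v))
  have key : ∀ K ∈ L, ∃ q ∈ B, Represents ns K.1 q.1 ∧ Represents ns K.2.1 q.2.1 ∧
      Represents ns K.2.2 q.2.2 := by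
    intro K hK
    obtain ⟨v, x, -, hv, h1, h2, h3⟩ := hk K hK
    refine ⟨(_, _, _), ?_, h1, h2, h3⟩
    refine Finset.mem_biUnion.2 ⟨v, by simpa using by omega, ?_⟩
    exact Finset.mem_product.2 ⟨ms v x, Finset.mem_product.2 ⟨mt v x, mr v x⟩⟩
  choose! q hq h1 h2 h3 using key
  rw [← List.toFinset_card_of_nodup hL]
  refine (Finset.card_le_card_of_injOn q (fun K hK => hq K (by simpa using hK)) ?_).trans hB
  intro K hK K' hK' e
  have hK := List.mem_toFinset.1 hK
  have hK' := List.mem_toFinset.1 hK'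
  have e1 := hns.canonical (h1 K hK) (e ▸ h1 K' hK')
  have e2 := hns.canonical (h2 K hK) (e ▸ h2 K' hK')
  have e3 := hns.canonical (h3 K hK) (e ▸ h3 K' hK')
  exact Prod.ext e1 (Prod.ext e2 e3)

/-- `M'` comes from the package `M` by `k` calls of `ite` from outside, each of which adds at most
`B` entries to the tables. -/
structure Grows (B k : ℕ) (M M' : Manager) : Prop where
  nodes_prefix : M.nodes <+: M'.nodes
  computed_mono : M.computed.length ≤ M'.computed.length
  computed_le : M'.computed.length ≤ M.computed.length + k * B
  nodes_le : M'.nodes.length ≤ M.nodes.length + k * B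
  time_le : M'.time ≤ M.time + k * ((2 * B + 1) * (M'.computed.length + M'.nodes.length + 3))

theorem Grows.trans {B k l : ℕ} {M₁ M₂ M₃ : Manager} (h : Grows B k M₁ M₂) (h' : Grows B l M₂ M₃) :
    Grows B (k + l) M₁ M₃ := by
  refine ⟨h.1.trans h'.1, h.2.trans h'.2, ?_, ?_, ?_⟩
  · have := h.computed_le
    have := h'.computed_le
    rw [add_mul]
    omega
  · have := h.nodes_le
    have := h'.nodes_le
    rw [add_mul]
    omega
  · have e1 := h.time_le
    have e2 := h'.time_le
    have h1 := h'.nodes_prefix.length_le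
    have h2 := h'.computed_mono
    have : k * ((2 * B + 1) * (M₂.computed.length + M₂.nodes.length + 3)) ≤
        k * ((2 * B + 1) * (M₃.computed.length + M₃.nodes.length + 3)) := by gcongr
    rw [add_mul]
    omega

/-- A single synthesis operation with `ite` on functions of small width. -/
theorem ite_grows {m w d F G H : ℕ} {f g h : (ℕ → Bool) → Bool} {M : Manager} (hM : Inv m M)
    (hd : m < d) (hF : Represents M.nodes F f) (hG : Represents M.nodes G g)
    (hH : Represents M.nodes H h) (wf : Width w f) (wg : Width w g) (wh : Width w h) :
    ∃ R M', M.ite d F G H = some (R, M') ∧ Inv m M' ∧ Represents M'.nodes R (iteFun f g h) ∧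
      Grows ((m + 1) * w ^ 3) 1 M M' := by
  -- At level 0 nothing is fixed, so the assignment `x` is arbitrary.
  obtain ⟨R, M', e, p⟩ := ite_spec (m := m) (f := f) (g := g) (h := h) d (v := 0)
    (x := fun _ => false) hM (Nat.zero_le _) (by omega) (by rwa [restrict_zero])
    (by rwa [restrict_zero]) (by rwa [restrict_zero])
  obtain ⟨L, hL, kL, nL, tL⟩ := p.table
  have hlen : L.length ≤ (m + 1) * w ^ 3 := by
    have hnd := p.inv.keys
    rw [hL, List.map_append] at hnd
    rw [← List.length_map Prod.fst]
    refine length_le_of_cofactorKeys p.inv.robdd wf wg wh (List.nodup_append.1 hnd).1 ?_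
    intro K hK
    obtain ⟨a, ha, rfl⟩ := List.mem_map.1 hK
    exact kL a ha
  have rep := p.represents
  simp only [restrict_zero] at rep
  refine ⟨R, M', e, p.inv, rep, p.nodes_prefix, by simp [hL], ?_, by omega, tL.trans ?_⟩
  · rw [hL, List.length_append]
    omega
  · rw [one_mul]
    gcongr

/-- Negation preserves width, so both calls made for an EXOR have operands of width `w`; the
constant operands need `1 ≤ w`. -/
theorem synth_grows {m w d F G : ℕ} {f g : (ℕ → Bool) → Bool} {M : Manager} (hM : Inv m M)
    (hd : m < d) (hF : Represents M.nodes F f) (hG : Represents M.nodes G g)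
    (wf : Width w f) (wg : Width w g) (hw : 1 ≤ w) (o : Op) :
    ∃ R M', o.synth d F G M = some (R, M') ∧ Inv m M' ∧
      Represents M'.nodes R (fun x => o.eval (f x) (g x)) ∧
      ∃ k ≤ 2, Grows ((m + 1) * w ^ 3) k M M' := by
  have w0 : Width w (fun _ => false) := (width_const false).mono hw
  have w1 : Width w (fun _ => true) := (width_const true).mono hw
  cases o with
  | and =>
    obtain ⟨R, M', e, hM', hR, hg⟩ := ite_grows hM hd hF hG (represents_zero _) wf wg w0
    refine ⟨R, M', e, hM', ?_, 1, by omega, hg⟩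
    convert hR using 2 with x
    cases hx : f x <;> simp [iteFun, Op.eval, hx]
  | or =>
    obtain ⟨R, M', e, hM', hR, hg⟩ := ite_grows hM hd hF (represents_one _) hG wf w1 wg
    refine ⟨R, M', e, hM', ?_, 1, by omega, hg⟩
    convert hR using 2 with x
    cases hx : f x <;> simp [iteFun, Op.eval, hx]
  | xor =>
    obtain ⟨N, M₁, e₁, hM₁, hN, hg₁⟩ :=
      ite_grows hM hd hG (represents_zero _) (represents_one _) wg w0 w1
    have hN' : Represents M₁.nodes N (fun x => !g x) := by
      convert hN using 2 with x
      cases hx : g x <;> simp [iteFun, hx]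
    obtain ⟨R, M', e, hM', hR, hg⟩ := ite_grows hM₁ hd (hF.prefix hg₁.nodes_prefix) hN'
      (hG.prefix hg₁.nodes_prefix) wf wg.not wg
    refine ⟨R, M', by simp [Op.synth, e₁, e], hM', ?_, 2, le_rfl, hg₁.trans hg⟩
    convert hR using 2 with x
    cases hx : f x <;> simp [iteFun, Op.eval, hx]

end Manager

/-! ### Symbolic simulation -/

section Simulation

variable {W : Type} [DecidableEq W]

/-- The effect of a gate on the values of the signals. -/
def Gate.update (e : W → Bool) (g : Gate W) : W → Bool :=
  Function.update e g.out (g.op.eval (e g.in₁) (e g.in₂))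

/-- The state `S` stores a BDD for each of the signals in `K`, whose values are given by `e`. -/
structure SimState.Inv (m : ℕ) (K : Set W) (e : (ℕ → Bool) → W → Bool) (S : SimState W) : Prop where
  manager : S.manager.Inv m
  signals : ∀ w ∈ K, ∃ F, S.bdds.lookup w = some F ∧
    Represents S.manager.nodes F (fun x => e x w)

theorem SimState.addGate_spec {m w d : ℕ} {K : Set W} {e : (ℕ → Bool) → W → Bool}
    {S : SimState W} (hS : S.Inv m K e) (hd : m < d) (hw : 1 ≤ w) {g : Gate W}
    (h₁ : g.in₁ ∈ K) (h₂ : g.in₂ ∈ K) (w₁ : Width w (fun x => e x g.in₁))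
    (w₂ : Width w (fun x => e x g.in₂)) :
    ∃ S', S.addGate d g = some S' ∧ S'.Inv m (insert g.out K) (fun x => g.update (e x)) ∧
      S'.bdds.length = S.bdds.length + 1 ∧
      ∃ k ≤ 2, Manager.Grows ((m + 1) * w ^ 3) k
        (S.manager.tick (2 * (S.bdds.length + 1))) S'.manager := by
  obtain ⟨F, lF, hF⟩ := hS.signals _ h₁
  obtain ⟨G, lG, hG⟩ := hS.signals _ h₂
  obtain ⟨R, M', es, hM', hR, k, hk, hg⟩ := Manager.synth_grows
    (M := S.manager.tick (2 * (S.bdds.length + 1))) hS.manager.tick hd hF hG w₁ w₂ hw g.op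
  refine ⟨⟨(g.out, R) :: S.bdds, M'⟩, ?_, ⟨hM', ?_⟩, rfl, k, hk, hg⟩
  · simp [addGate, lF, lG, es]
  · intro s hs
    -- The new pair stands at the front of the list, so `lookup` changes exactly as
    -- `Function.update` does.
    by_cases hso : s = g.out
    · subst hso
      refine ⟨R, by simp, ?_⟩
      simpa [Gate.update] using hR
    · obtain ⟨E, lE, hE⟩ := hS.signals s (hs.resolve_left hso)
      refine ⟨E, ?_, ?_⟩
      · simp only [List.lookup_cons, beq_false_of_ne hso]
        exact lE
      · simpa [Gate.update, Function.update_of_ne hso] using hE.prefix hg.nodes_prefix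

/-- The `gates` are in topological order, starting from the signals in `K`, and each of them
preserves the property `Good` of the functions at the signals. -/
def Preserves (Good : W → ((ℕ → Bool) → Bool) → Prop) : Set W → List (Gate W) → Prop
  | _, [] => True
  | K, g :: gs => g.in₁ ∈ K ∧ g.in₂ ∈ K ∧
    (∀ f₁ f₂, Good g.in₁ f₁ → Good g.in₂ f₂ → Good g.out fun x => g.op.eval (f₁ x) (f₂ x)) ∧
    Preserves Good (insert g.out K) gs

/-- Width alone is no inductive invariant, because it multiplies at each gate. The invariant is
therefore `Good`, which can pin down the function at a signal and from which a uniform width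
follows. -/
theorem SimState.addGates_spec {m w d : ℕ} {Good : W → ((ℕ → Bool) → Bool) → Prop}
    (hGood : ∀ s f, Good s f → Width w f) (hd : m < d) (hw : 1 ≤ w) (gs : List (Gate W)) :
    ∀ {K : Set W} {e : (ℕ → Bool) → W → Bool} {S : SimState W}, S.Inv m K e →
      (∀ s ∈ K, Good s fun x => e x s) → Preserves Good K gs →
      ∃ S', gs.foldlM (SimState.addGate d) S = some S' ∧
        S'.Inv m (K ∪ {s | s ∈ gs.map Gate.out}) (fun x => gs.foldl Gate.update (e x)) ∧
        S'.bdds.length = S.bdds.length + gs.length ∧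
        S.manager.computed.length ≤ S'.manager.computed.length ∧
        S.manager.nodes.length ≤ S'.manager.nodes.length ∧
        S'.manager.computed.length ≤
          S.manager.computed.length + gs.length * (2 * ((m + 1) * w ^ 3)) ∧
        S'.manager.nodes.length ≤
          S.manager.nodes.length + gs.length * (2 * ((m + 1) * w ^ 3)) ∧
        S'.manager.time ≤ S.manager.time + gs.length * (2 * (S'.bdds.length + 1) +
          2 * ((2 * ((m + 1) * w ^ 3) + 1) *
            (S'.manager.computed.length + S'.manager.nodes.length + 3))) := by
  induction gs with
  | nil =>
    intro K e S hS _ _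
    exact ⟨S, rfl, by simpa using hS, by simp⟩
  | cons g gs ih =>
    intro K e S hS hK hP
    obtain ⟨h₁, h₂, hg, hP⟩ := hP
    obtain ⟨S₁, e₁, hS₁, b₁, k, hk, r⟩ := SimState.addGate_spec hS hd hw h₁ h₂
      (hGood _ _ (hK _ h₁)) (hGood _ _ (hK _ h₂))
    obtain ⟨S', e', hS', b', cm', nm', c', n', t'⟩ := ih hS₁ (by
      intro s hs
      by_cases hso : s = g.out
      · subst hso
        simpa [Gate.update] using hg _ _ (hK _ h₁) (hK _ h₂)
      · simpa [Gate.update, Function.update_of_ne hso] using hK s (hs.resolve_left hso)) hP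
    have r1 := r.nodes_prefix.length_le
    have r2 := r.computed_mono
    have r3 := r.computed_le
    have r4 := r.nodes_le
    have r5 := r.time_le
    simp only [Manager.tick] at r1 r2 r3 r4 r5
    set B := (m + 1) * w ^ 3
    have hkB : k * B ≤ 2 * B := Nat.mul_le_mul_right _ hk
    refine ⟨S', by simp [List.foldlM_cons, e₁, e'], ?_, ?_, by omega, by omega, ?_, ?_, ?_⟩
    · have hK' : K ∪ {s | s ∈ (g :: gs).map Gate.out} =
          insert g.out K ∪ {s | s ∈ gs.map Gate.out} := by
        ext s
        simp only [Set.mem_union, Set.mem_ofPred_eq, List.map_cons, List.mem_cons,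
          Set.mem_insert_iff]
        tauto
      rw [hK']
      exact hS'
    · simp only [List.length_cons]
      omega
    · rw [List.length_cons, add_mul]
      omega
    · rw [List.length_cons, add_mul]
      omega
    · have : k * ((2 * B + 1) * (S₁.manager.computed.length + S₁.manager.nodes.length + 3)) ≤
          2 * ((2 * B + 1) * (S'.manager.computed.length + S'.manager.nodes.length + 3)) := by
        gcongr
      rw [List.length_cons, add_mul]
      omega

theorem SimState.addInputs_spec (inputs : List W) (hnd : inputs.Nodup) (l : List W) :
    ∀ {pre : List W} {S : SimState W}, inputs = pre ++ l →
      S.Inv inputs.length {s | s ∈ pre} (fun x w => x (inputs.idxOf w)) →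
      S.manager.computed = [] → S.manager.nodes.length ≤ pre.length →
      S.bdds.length = pre.length →
      S.manager.time ≤ pre.length * (inputs.length + 2) →
      ∃ S', (l.zipIdx pre.length).foldl (fun S wv => S.addInput wv.1 wv.2) S = S' ∧
        S'.Inv inputs.length {s | s ∈ inputs} (fun x w => x (inputs.idxOf w)) ∧
        S'.manager.computed = [] ∧ S'.manager.nodes.length ≤ inputs.length ∧
        S'.bdds.length = inputs.length ∧
        S'.manager.time ≤ inputs.length * (inputs.length + 2) := by
  induction l with
  | nil =>
    intro pre S hpre hS hc hn hb ht
    rw [List.append_nil] at hpre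
    subst hpre
    exact ⟨S, rfl, hS, hc, hn, hb, ht⟩
  | cons s l ih =>
    intro pre S hpre hS hc hn hb ht
    have hlen : pre.length < inputs.length := by simp [hpre]
    obtain ⟨R, M', e, hM', hp, hR, c', n', t'⟩ := Manager.reduceOrFind_spec
      (M := S.manager.tick 1) hS.manager.robdd hlen (represents_zero _) (represents_one _)
      (.inl rfl) (.inr (.inl rfl))
    have hs : s ∉ pre := by
      rw [hpre] at hnd
      intro h
      exact (List.nodup_append.1 hnd).2.2 s h s (by simp) rfl
    have hidx : inputs.idxOf s = pre.length := by
      rw [hpre, List.idxOf_append_of_notMem hs]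
      simp
    have hadd : S.addInput s pre.length = ⟨(s, R) :: S.bdds, M'⟩ := by
      simp [addInput, e]
    have step := ih (pre := pre ++ [s]) (S := S.addInput s pre.length) (by simp [hpre])
    rw [hadd] at step
    simp only [Manager.tick] at hp n' t' c'
    rw [List.zipIdx_cons, List.foldl_cons]
    simp only [hadd]
    rw [List.length_append, List.length_singleton] at step
    refine step ⟨⟨hM', by simp [c', hc], by simp [c', hc]⟩, ?_⟩ (by simp [c', hc])
      (by simpa using by omega) (by simp [hb]) ?_
    · intro t ht
      by_cases hts : t = s
      · subst hts
        refine ⟨R, by simp, ?_⟩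
        simp only [hidx]
        convert hR using 2 with x
        simp
      · have ht : t ∈ pre := by simpa [hts] using ht
        obtain ⟨F, lF, hF⟩ := hS.signals t ht
        refine ⟨F, ?_, hF.prefix hp⟩
        simp only [List.lookup_cons, beq_false_of_ne hts]
        exact lF
    -- One input costs one step and a scan of at most `pre.length` nodes, within `inputs.length +
    -- 2`.
    · simp only [add_mul, one_mul]
      omega

/-- Symbolic simulation of a circuit with functions of width at most `w` at all signals. -/
theorem Circuit.simulate_spec {w : ℕ} {Good : W → ((ℕ → Bool) → Bool) → Prop}
    (hGood : ∀ s f, Good s f → Width w f) (hw : 1 ≤ w) (C : Circuit W) (hnd : C.inputs.Nodup)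
    (hin : ∀ s ∈ C.inputs, Good s fun x => x (C.inputs.idxOf s))
    (hP : Preserves Good {s | s ∈ C.inputs} C.gates) :
    ∃ S, C.simulate = some S ∧ IsROBDD C.inputs.length S.manager.nodes ∧
      (∀ s ∈ C.signals, ∃ F, S.bdds.lookup s = some F ∧
        Represents S.manager.nodes F (fun x => C.value x s)) ∧
      S.bdds.length = C.inputs.length + C.gates.length ∧
      S.manager.computed.length ≤
        C.gates.length * (2 * ((C.inputs.length + 1) * w ^ 3)) ∧
      S.manager.nodes.length ≤ C.inputs.length +
        C.gates.length * (2 * ((C.inputs.length + 1) * w ^ 3)) ∧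
      S.manager.time ≤ C.inputs.length * (C.inputs.length + 2) +
        C.gates.length * (2 * (S.bdds.length + 1) +
          2 * ((2 * ((C.inputs.length + 1) * w ^ 3) + 1) *
            (S.manager.computed.length + S.manager.nodes.length + 3))) := by
  obtain ⟨S₀, e₀, hS₀, c₀, n₀, b₀, t₀⟩ := SimState.addInputs_spec C.inputs hnd C.inputs
    (pre := []) (S := ⟨[], Manager.empty⟩) rfl
    ⟨⟨⟨by simp [Manager.empty], by simp [Manager.empty], by simp [Manager.empty],
      by simp [Manager.empty]⟩, by simp [Manager.empty], by simp [Manager.empty]⟩, by simp⟩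
    rfl (by simp [Manager.empty]) rfl (by simp [Manager.empty])
  obtain ⟨S, e, hS, b, -, -, c, n, t⟩ := SimState.addGates_spec (d := C.depthBound) hGood
    (Nat.lt_succ_self _) hw C.gates hS₀ hin hP
  refine ⟨S, ?_, hS.manager.robdd, ?_, by omega, ?_, by omega, by omega⟩
  · rw [← e, ← e₀]
    rfl
  · intro s hs
    exact hS.signals s (by simpa [Circuit.signals] using hs)
  · simpa [c₀] using c

end Simulation

end PolyAdd

namespace PolyAdd

/-! ### Functions computed by a finite automaton along the variable order -/

/-- The state of an automaton that has read the operand bits of the positions below `t`. -/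
def run {σ : Type} (δ : ℕ → σ → Bool → Bool → σ) (s₀ : σ) (x : ℕ → Bool) : ℕ → σ
  | 0 => s₀
  -- Variable 0 is `c_{-1}`, so `a_t` and `b_t` are the variables `2t+1` and `2t+2`.
  | t + 1 => δ t (run δ s₀ x t) (x (2 * t + 1)) (x (2 * t + 2))

theorem run_congr {σ : Type} (δ : ℕ → σ → Bool → Bool → σ) (s₀ : σ) {x y : ℕ → Bool} {t : ℕ}
    (h : ∀ u, 1 ≤ u → u ≤ 2 * t → x u = y u) : run δ s₀ x t = run δ s₀ y t := by
  induction t with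
  | zero => rfl
  | succ t ih =>
    simp only [run]
    rw [ih fun u h1 h2 => h u h1 (by omega), h _ (by omega) (by omega),
      h (2 * t + 2) (by omega) (by omega)]

/-- After `v` variables, `(v-1)/2` positions have been read completely and at most one bit, `x
(v-1)`, is pending. Automaton state and pending bit give `2 * 2` possibilities; the `min` stops the
automaton at `N`. -/
theorem width_run (δ : ℕ → Bool → Bool → Bool → Bool) (s₀ : Bool) (N : ℕ) :
    Width 4 (fun x => run δ s₀ x N) := by
  refine Width.of_state (τ := Bool × Bool)
    (fun v x => (run δ s₀ x (min ((v - 1) / 2) N), x (v - 1))) fun v x y z h => ?_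
  obtain ⟨h1, h2⟩ := Prod.mk.inj h
  have base : ∀ t ≤ (v - 1) / 2, ∀ w, run δ s₀ (mix v w z) t = run δ s₀ w t :=
    fun t ht w => run_congr _ _ fun u hu1 hu2 => if_pos (by omega)
  rcases le_total N ((v - 1) / 2) with hN | hN
  · rw [min_eq_right hN] at h1
    rw [base N hN, base N hN, h1]
  · rw [min_eq_left hN] at h1
    induction N, hN using Nat.le_induction with
    | base => rw [base _ le_rfl, base _ le_rfl, h1]
    | succ t ht ih =>
      have bit : ∀ u, v - 1 ≤ u → mix v x z u = mix v y z u := by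
        intro u hu
        simp only [mix]
        split
        · obtain rfl : u = v - 1 := by omega
          exact h2
        · rfl
      simp only [run]
      rw [ih (by rw [min_eq_left ht, h1, h2]), bit _ (by omega), bit (2 * t + 2) (by omega)]

/-! ### Propagation and generation of carries -/

/-- A carry is propagated through all positions from `i` up to, but not including, `t`. -/
def prop (i t : ℕ) (x : ℕ → Bool) : Bool :=
  run (fun t s a b => if t < i then true else s && Bool.xor a b) true x t

/-- A carry is generated at the positions from `i` up to, but not including, `t`. -/
def gen (i t : ℕ) (x : ℕ → Bool) : Bool :=
  run (fun t s a b => if t < i then false else (a && b) || (s && Bool.xor a b)) false x t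

theorem prop_self (i : ℕ) (x : ℕ → Bool) : prop i i x = true := by
  cases i <;> simp [prop, run]

theorem gen_self (i : ℕ) (x : ℕ → Bool) : gen i i x = false := by
  cases i <;> simp [gen, run]

theorem prop_succ {i t : ℕ} (h : i ≤ t) (x : ℕ → Bool) :
    prop i (t + 1) x = (prop i t x && Bool.xor (x (2 * t + 1)) (x (2 * t + 2))) := by
  simp [prop, run, h.not_gt]

theorem gen_succ {i t : ℕ} (h : i ≤ t) (x : ℕ → Bool) :
    gen i (t + 1) x = ((x (2 * t + 1) && x (2 * t + 2)) ||
      (gen i t x && Bool.xor (x (2 * t + 1)) (x (2 * t + 2)))) := by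
  simp [gen, run, h.not_gt]

theorem prop_split {i k t : ℕ} (hik : i ≤ k) (hkt : k ≤ t) (x : ℕ → Bool) :
    prop i t x = (prop i k x && prop k t x) := by
  induction t, hkt using Nat.le_induction with
  | base => simp [prop_self]
  | succ t ht ih => rw [prop_succ (hik.trans ht), prop_succ ht, ih, Bool.and_assoc]

/-- A carry leaving the whole interval arises in the upper part, or in the lower part and is
propagated through the upper one. This holds for every `k`, so the shape of the prefix block is
immaterial. -/
theorem gen_split {i k t : ℕ} (hik : i ≤ k) (hkt : k ≤ t) (x : ℕ → Bool) :
    gen i t x = (gen k t x || (gen i k x && prop k t x)) := by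
  induction t, hkt using Nat.le_induction with
  | base => simp [prop_self, gen_self]
  | succ t ht ih =>
    rw [gen_succ (hik.trans ht), gen_succ ht, prop_succ ht, ih]
    generalize Bool.xor _ _ = c
    cases c <;> simp [Bool.or_assoc]

theorem width_prop (i t : ℕ) : Width 4 (prop i t) := width_run _ _ _

theorem width_gen (i t : ℕ) : Width 4 (gen i t) := width_run _ _ _

/-- The carry into position `i`. -/
def carry (i : ℕ) (x : ℕ → Bool) : Bool := gen 0 i x || (prop 0 i x && x 0)

theorem carry_zero (x : ℕ → Bool) : carry 0 x = x 0 := by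
  simp [carry, gen_self, prop_self]

/-! ### The signals of the adder -/

/-- The function `f` is the one that an adder with the given prefix cells has at the signal. -/
def Wire.Good (cells : List Cell) : Wire → ((ℕ → Bool) → Bool) → Prop
  | .cin, f => f = fun x => x 0
  | .a i, f => f = fun x => x (2 * i + 1)
  | .b i, f => f = fun x => x (2 * i + 2)
  | .p j i, f => f = prop i (j + 1)
  | .g j i, f => f = gen i (j + 1)
  -- Unlike `p` and `g`, this signal depends on where the cell splits its interval.
  | .gp j i, f => ∃ c ∈ cells, c.j = j ∧ c.i = i ∧
      f = fun x => gen i (c.k + 1) x && prop (c.k + 1) (j + 1) x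
  | .pc i, f => f = fun x => prop 0 (i + 1) x && x 0
  | .c i, f => f = carry (i + 1)
  | .ab i, f => f = fun x => Bool.xor (x (2 * i + 1)) (x (2 * i + 2))
  | .s i, f => f = fun x => Bool.xor (Bool.xor (x (2 * i + 1)) (x (2 * i + 2))) (carry i x)

/-- A carry has width at most `4 * (4 * 2) = 32`. The sum bit is the worst case: EXOR with `a_i ⊕
b_i`, of width 4, gives 128. -/
theorem Wire.Good.width {cells : List Cell} {s : Wire} {f : (ℕ → Bool) → Bool}
    (h : s.Good cells f) : Width 128 f := by
  have hc : ∀ i, Width 32 (carry i) := fun i =>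
    (width_gen 0 i).op ((width_prop 0 i).op (width_var 0) and) or
  have hab : ∀ i, Width 4 (fun x => Bool.xor (x (2 * i + 1)) (x (2 * i + 2))) := fun i =>
    (width_var _).op (width_var _) Bool.xor
  cases s with
  | cin =>
    subst h
    exact (width_var _).mono (by norm_num)
  | a i =>
    subst h
    exact (width_var _).mono (by norm_num)
  | b i =>
    subst h
    exact (width_var _).mono (by norm_num)
  | p j i =>
    subst h
    exact (width_prop _ _).mono (by norm_num)
  | g j i =>
    subst h
    exact (width_gen _ _).mono (by norm_num)
  | gp j i =>
    obtain ⟨c, -, -, -, rfl⟩ := h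
    exact ((width_gen _ _).op (width_prop _ _) and).mono (by norm_num)
  | pc i =>
    subst h
    exact ((width_prop _ _).op (width_var _) and).mono (by norm_num)
  | c i =>
    subst h
    exact (hc _).mono (by norm_num)
  | ab i =>
    subst h
    exact (hab i).mono (by norm_num)
  | s i =>
    subst h
    exact ((hab i).op (hc i) Bool.xor).mono (by norm_num)

/-! ### Composition of gate lists in topological order -/

section Preserves

variable {W : Type} {Good : W → ((ℕ → Bool) → Bool) → Prop}

theorem Preserves.mono {gs : List (Gate W)} {K K' : Set W} (h : Preserves Good K gs)
    (hK : K ⊆ K') : Preserves Good K' gs := by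
  induction gs generalizing K K' with
  | nil => trivial
  | cons g gs ih =>
    exact ⟨hK h.1, hK h.2.1, h.2.2.1, ih h.2.2.2 (Set.insert_subset_insert hK)⟩

theorem Preserves.append {gs gs' : List (Gate W)} {K : Set W} (h : Preserves Good K gs)
    (h' : Preserves Good (K ∪ {s | s ∈ gs.map Gate.out}) gs') : Preserves Good K (gs ++ gs') := by
  induction gs generalizing K with
  | nil => exact h'.mono (by simp)
  | cons g gs ih =>
    refine ⟨h.1, h.2.1, h.2.2.1, ih h.2.2.2 (h'.mono ?_)⟩
    rintro s (hs | hs)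
    · exact .inl (.inr hs)
    · rcases List.mem_cons.1 hs with rfl | hs
      · exact .inl (.inl rfl)
      · exact .inr hs

theorem mem_out_flatMap {α : Type} {f : α → List (Gate W)} {l : List α} {a : α} {s : W}
    (ha : a ∈ l) (hs : s ∈ (f a).map Gate.out) : s ∈ (l.flatMap f).map Gate.out :=
  let ⟨g, hg, e⟩ := List.mem_map.1 hs
  List.mem_map.2 ⟨g, List.mem_flatMap.2 ⟨a, ha, hg⟩, e⟩

/-- The decomposition `pre ++ a :: post` has the form of `PrefixBlock.topological`, so each cell may
use the outputs of the earlier ones. -/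
theorem Preserves.flatMap {α : Type} (f : α → List (Gate W)) (l : List α) {K : Set W}
    (h : ∀ pre a post, l = pre ++ a :: post →
      Preserves Good (K ∪ {s | s ∈ (pre.flatMap f).map Gate.out}) (f a)) :
    Preserves Good K (l.flatMap f) := by
  induction l generalizing K with
  | nil => trivial
  | cons a l ih =>
    rw [List.flatMap_cons]
    refine Preserves.append ((h [] a l rfl).mono (by simp)) (ih fun pre b post e => ?_)
    refine (h (a :: pre) b post (by simp [e])).mono ?_
    rintro s (hs | hs)
    · exact .inl (.inl hs)
    · rw [List.flatMap_cons, List.map_append] at hs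
      rcases List.mem_append.1 hs with hs | hs
      · exact .inl (.inr hs)
      · exact .inr hs

theorem Preserves.flatMap_of_forall {α : Type} {f : α → List (Gate W)} {l : List α} {K : Set W}
    (h : ∀ a ∈ l, Preserves Good K (f a)) : Preserves Good K (l.flatMap f) :=
  Preserves.flatMap f l fun _ a _ e => (h a (by simp [e])).mono Set.subset_union_left

end Preserves

/-! ### The carry look ahead adder -/

/-- The operand bits of the positions below `n`, in the variable order. -/
def operandBits (n : ℕ) : List Wire := (List.range n).flatMap fun i => [.a i, .b i]

theorem operandBits_succ (n : ℕ) : operandBits (n + 1) = operandBits n ++ [.a n, .b n] := by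
  simp [operandBits, List.range_succ]

theorem length_operandBits (n : ℕ) : (operandBits n).length = 2 * n := by
  induction n with
  | zero => rfl
  | succ n ih =>
    rw [operandBits_succ, List.length_append, ih]
    simp
    omega

theorem mem_operandBits {n : ℕ} {s : Wire} :
    s ∈ operandBits n ↔ ∃ i < n, s = .a i ∨ s = .b i := by
  simp [operandBits]

theorem idxOf_operandBits (n i : ℕ) (hi : i < n) :
    (operandBits n).idxOf (.a i) = 2 * i ∧ (operandBits n).idxOf (.b i) = 2 * i + 1 := by
  induction n with
  | zero => omega
  | succ n ih =>
    rw [operandBits_succ]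
    rcases (Nat.lt_succ_iff_lt_or_eq.1 hi) with hlt | rfl
    · rw [List.idxOf_append_of_mem (mem_operandBits.2 ⟨i, hlt, .inl rfl⟩),
        List.idxOf_append_of_mem (mem_operandBits.2 ⟨i, hlt, .inr rfl⟩)]
      exact ih hlt
    · rw [List.idxOf_append_of_notMem (by simp [mem_operandBits]),
        List.idxOf_append_of_notMem (by simp [mem_operandBits]), length_operandBits]
      simp

theorem nodup_operandBits (n : ℕ) : (operandBits n).Nodup := by
  induction n with
  | zero => simp [operandBits]
  | succ n ih =>
    rw [operandBits_succ, List.nodup_append]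
    refine ⟨ih, by simp, ?_⟩
    intro s hs t ht hst
    obtain ⟨i, hi, h⟩ := mem_operandBits.1 hs
    have ht : t = .a n ∨ t = .b n := by simpa using ht
    rcases h with rfl | rfl <;> rcases ht with rfl | rfl <;> simp at hst <;> omega

section Adder

variable {n : ℕ} (P : PrefixBlock n)

theorem cla_inputs : (cla n P).inputs = .cin :: operandBits n := rfl

theorem length_cla_inputs : (cla n P).inputs.length = 2 * n + 1 := by
  rw [cla_inputs, List.length_cons, length_operandBits]

theorem nodup_cla_inputs : (cla n P).inputs.Nodup := by
  rw [cla_inputs, List.nodup_cons]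
  exact ⟨by simp [mem_operandBits], nodup_operandBits n⟩

theorem good_cla_inputs (s : Wire) (hs : s ∈ (cla n P).inputs) :
    s.Good P.cells fun x => x ((cla n P).inputs.idxOf s) := by
  rw [cla_inputs] at hs ⊢
  rcases List.mem_cons.1 hs with rfl | hs
  · simp [Wire.Good]
  · obtain ⟨i, hi, rfl | rfl⟩ := mem_operandBits.1 hs
    · rw [List.idxOf_cons_ne _ (by simp), (idxOf_operandBits n i hi).1]
      rfl
    · rw [List.idxOf_cons_ne _ (by simp), (idxOf_operandBits n i hi).2]
      rfl

/-- The operand `(j, k+1)` has the same upper end `j` as the cell's result, so the bound passes down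
from a single position or an earlier cell. -/
theorem PrefixBlock.lt_of_mem (c : Cell) (hc : c ∈ P.cells) : c.j < n := by
  suffices H : ∀ post pre, P.cells = pre ++ post → (∀ c ∈ pre, c.j < n) →
      ∀ c ∈ P.cells, c.j < n from H P.cells [] rfl (by simp) c hc
  intro post
  induction post with
  | nil =>
    intro pre e h
    rw [e, List.append_nil]
    exact h
  | cons c post ih =>
    intro pre e h
    refine ih (pre ++ [c]) (by simp [e]) fun c' hc' => ?_
    rcases List.mem_append.1 hc' with hc' | hc'
    · exact h c' hc'
    · rw [List.mem_singleton.1 hc']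
      rcases (P.topological pre c post e).1 with ⟨h1, h2⟩ | ⟨c'', hc'', h1, -⟩
      · omega
      · exact h1 ▸ h c'' hc''

theorem PrefixBlock.length_cells_le : P.cells.length ≤ n ^ 2 := by
  have := Finset.card_le_card (s := (P.cells.map fun c => (c.j, c.i)).toFinset)
    (t := Finset.range n ×ˢ Finset.range n) fun q hq => by
      obtain ⟨c, hc, rfl⟩ := List.mem_map.1 (List.mem_toFinset.1 hq)
      have h1 := P.lt_of_mem c hc
      have h2 := P.split c hc
      simpa using by omega
  rw [List.toFinset_card_of_nodup P.nodup] at this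
  simpa [pow_two] using this

theorem length_cla_gates_le : (cla n P).gates.length ≤ 3 * n ^ 2 + 6 * n := by
  have := P.length_cells_le
  simp [cla, List.length_flatMap]
  omega

/-- Each gate equation is an identity between `prop`, `gen` and `carry`: `prop_split` and
`gen_split` serve the cells, the definition of `carry` the carry bits. -/
theorem preserves_cla_gates :
    Preserves (Wire.Good P.cells) {s | s ∈ (cla n P).inputs} (cla n P).gates := by
  have hcin : Wire.cin ∈ (cla n P).inputs := by simp [cla_inputs]
  have ha : ∀ i < n, Wire.a i ∈ (cla n P).inputs := fun i hi => by
    simp [cla_inputs, mem_operandBits, hi]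
  have hb : ∀ i < n, Wire.b i ∈ (cla n P).inputs := fun i hi => by
    simp [cla_inputs, mem_operandBits, hi]
  generalize hI : (cla n P).inputs = I at hcin ha hb
  have avail : ∀ {K : Set Wire} {cells : List Cell} {j i : ℕ}, Available n cells j i →
      (∀ i < n, Wire.p i i ∈ K ∧ Wire.g i i ∈ K) →
      (∀ c ∈ cells, Wire.p c.j c.i ∈ K ∧ Wire.g c.j c.i ∈ K) → Wire.p j i ∈ K ∧ Wire.g j i ∈ K := by
    rintro K cells j i (⟨rfl, h⟩ | ⟨c, hc, rfl, rfl⟩) h1 h2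
    · exact h1 _ h
    · exact h2 c hc
  refine Preserves.append (Preserves.append (Preserves.append ?_ ?_) ?_) ?_
  · refine Preserves.flatMap_of_forall fun i hi => ?_
    have hi := List.mem_range.1 hi
    refine ⟨ha i hi, hb i hi, ?_, .inr (ha i hi), .inr (hb i hi), ?_, trivial⟩
    · rintro f₁ f₂ rfl rfl
      funext x
      simp [Op.eval, prop_succ, prop_self]
    · rintro f₁ f₂ rfl rfl
      funext x
      simp [Op.eval, gen_succ, gen_self]
  · refine Preserves.flatMap _ _ fun pre c post e => ?_
    obtain ⟨t1, t2⟩ := P.topological pre c post e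
    obtain ⟨h1, h2⟩ := P.split c (by simp [e])
    generalize hK : ({s | s ∈ I} ∪ _ ∪ _ : Set Wire) = K
    have k1 : ∀ i < n, Wire.p i i ∈ K ∧ Wire.g i i ∈ K := by
      intro i hi
      have hi := List.mem_range.2 hi
      subst hK
      exact ⟨.inl (.inr (mem_out_flatMap hi (by simp))),
        .inl (.inr (mem_out_flatMap hi (by simp)))⟩
    have k2 : ∀ c ∈ pre, Wire.p c.j c.i ∈ K ∧ Wire.g c.j c.i ∈ K := by
      intro c hc
      subst hK
      exact ⟨.inr (mem_out_flatMap hc (by simp)), .inr (mem_out_flatMap hc (by simp))⟩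
    obtain ⟨p1, g1⟩ := avail t1 k1 k2
    obtain ⟨p2, g2⟩ := avail t2 k1 k2
    refine ⟨p2, p1, ?_, .inr g2, .inr p1, ?_, .inr (.inr g1), .inl rfl, ?_, trivial⟩
    · rintro f₁ f₂ rfl rfl
      funext x
      exact (prop_split (by omega) (by omega) x).symm
    · rintro f₁ f₂ rfl rfl
      exact ⟨c, by simp [e], rfl, rfl, rfl⟩
    · rintro f₁ f₂ rfl ⟨c', hc', hj, hi, rfl⟩
      -- As no interval is computed twice, the cell behind the `gp` signal is the present one, so
      -- the split points agree.
      obtain rfl : c' = c := List.inj_on_of_nodup_map P.nodup hc' (by simp [e]) (by simp [hj, hi])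
      funext x
      exact (gen_split (by omega) (by omega) x).symm
  · refine Preserves.flatMap_of_forall fun i hi => ?_
    have hi := List.mem_range.1 hi
    generalize hK : ({s | s ∈ I} ∪ _ : Set Wire) = K
    obtain ⟨hp, hg⟩ := avail (K := K) (P.complete i hi) (by
      intro i hi
      have hi := List.mem_range.2 hi
      subst hK
      rw [List.map_append]
      exact ⟨.inr (List.mem_append_left _ (mem_out_flatMap hi (by simp))),
        .inr (List.mem_append_left _
          (mem_out_flatMap hi (by simp)))⟩) (by
      intro c hc
      subst hK
      rw [List.map_append]
      exact ⟨.inr (List.mem_append_right _ (mem_out_flatMap hc (by simp))),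
        .inr (List.mem_append_right _ (mem_out_flatMap hc
          (by simp)))⟩)
    refine ⟨hp, hK ▸ .inl hcin, ?_, .inr hg, .inl rfl, ?_, trivial⟩
    · rintro f₁ f₂ rfl rfl
      rfl
    · rintro f₁ f₂ rfl rfl
      rfl
  · refine Preserves.flatMap_of_forall fun i hi => ?_
    have hi := List.mem_range.1 hi
    refine ⟨.inl (ha i hi), .inl (hb i hi), ?_, .inl rfl, .inr ?_, ?_, trivial⟩
    · rintro f₁ f₂ rfl rfl
      rfl
    -- The carry into position 0 is the input `c_{-1}`; any other is an output of the preceding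
    -- group of gates.
    · cases i with
      | zero => exact .inl hcin
      | succ i =>
        refine .inr ?_
        rw [List.map_append]
        exact List.mem_append_right _ (mem_out_flatMap (List.mem_range.2 (Nat.lt_of_succ_lt hi))
          (by simp [Wire.carryInto]))
    · rintro f₁ f₂ rfl h₂
      have : f₂ = carry i := by
        cases i with
        | zero => exact h₂.trans (funext fun x => (carry_zero x).symm)
        | succ i => exact h₂
      subst this
      rfl

end Adder

end PolyAdd

/-! ### The polynomial bound on time and space -/

open Polynomial in
theorem theorem4 :
    ∃ T : Polynomial ℕ, ∀ (n : ℕ) (P : PolyAdd.PrefixBlock n),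
      ∃ S : PolyAdd.SimState PolyAdd.Wire,
        (PolyAdd.cla n P).simulate = some S ∧
        PolyAdd.IsROBDD (2 * n + 1) S.manager.nodes ∧
        (∀ w ∈ (PolyAdd.cla n P).signals, ∃ F : ℕ, S.bdds.lookup w = some F ∧
          PolyAdd.Represents S.manager.nodes F (fun x => (PolyAdd.cla n P).value x w)) ∧
        S.manager.time ≤ T.eval n ∧
        (PolyAdd.cla n P).space S ≤ T.eval n := by
  -- `m` counts the inputs, `k` bounds the number of gates, and `B` bounds the table growth per
  -- outer call of `ite` at width 128.
  let m : ℕ[X] := 2 * X + 1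
  let k : ℕ[X] := 3 * X ^ 2 + 6 * X
  let B : ℕ[X] := (m + 1) * 128 ^ 3
  -- The polynomial is the sum of the time bound and the space bound, so it dominates each. The
  -- factor in `2 * B` allows for the two calls of an EXOR gate, except in `2 * B + 1`, which counts
  -- the calls inside one `ite`.
  refine ⟨(m * (m + 2) + k * (2 * (m + k + 1) + 2 * ((2 * B + 1) *
    (k * (2 * B) + (m + k * (2 * B)) + 3)))) +
    ((m + k * (2 * B)) + 2 + k * (2 * B) + (m + k) + (m + 1)), fun n P => ?_⟩
  obtain ⟨S, hS, hR, hs, hb, hc, hn, ht⟩ := PolyAdd.Circuit.simulate_spec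
    (fun _ _ => PolyAdd.Wire.Good.width) (by norm_num) (PolyAdd.cla n P)
    (PolyAdd.nodup_cla_inputs P) (PolyAdd.good_cla_inputs P) (PolyAdd.preserves_cla_gates P)
  have hk := PolyAdd.length_cla_gates_le P
  have em : m.eval n = 2 * n + 1 := by simp [m]
  have ek : k.eval n = 3 * n ^ 2 + 6 * n := by simp [k]
  have eB : B.eval n = (2 * n + 1 + 1) * 128 ^ 3 := by simp [B, em]
  simp only [PolyAdd.length_cla_inputs, ← eB] at hR hb hc hn ht
  rw [← em] at hb hn ht
  rw [← ek] at hk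
  have hc' := hc.trans (Nat.mul_le_mul_right _ hk)
  have hn' := hn.trans (Nat.add_le_add_left (Nat.mul_le_mul_right _ hk) _)
  have hb' := hb.le.trans (Nat.add_le_add_left hk _)
  refine ⟨S, hS, hR, hs, ?_, ?_⟩
  · refine ht.trans ?_
    simp only [eval_add, eval_mul, eval_ofNat, eval_one]
    refine le_trans ?_ (Nat.le_add_right _ _)
    gcongr
  · simp only [eval_add, eval_mul, eval_ofNat, eval_one, PolyAdd.Circuit.space,
      PolyAdd.Circuit.depthBound, PolyAdd.length_cla_inputs, ← em]
    refine le_trans ?_ (Nat.le_add_left _ _)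
    gcongr
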